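/- All graphs are finite and simple. A graph $G$ is $(7,2)$-edge-choosable if, for every assignment $L$ of a list $L(e)$ of exactly $7$ colors to each edge $e$ of $G$, one can choose a $2$-element subset $\varphi(e)\subseteq L(e)$ for each edge $e$ so that $\varphi(e)\cap\varphi(f)=\emptyset$ whenever $e$ and $f$ are distinct edges with a common endpoint. A double-star is a $6$-vertex tree having two adjacent vertices of degree $3$; its other four vertices are its leaves. A MED decomposition of a $3$-regular graph $G$ consists of subgraphs $G_1,G_2,G_3$ of $G$ whose edge sets partition $E(G)$, such that $G_1$ is a matching, every connected component of $G_2$ is a cycle of even length, every connected component of $G_3$ is a double-star, and the set of all leaves of the components of $G_3$ is an independent set of vertices of $G$. (Any of $G_1,G_2,G_3$ may be empty.) **Theorem.** Every $3$-regular graph having a MED decomposition is $(7,2)$-edge-choosable. -/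

import Mathlib

universe u w

namespace MED

variable {V : Type u}

/-- `φ` is an `s`-set `L`-coloring of the edges of `G`: it selects `s` colors from the list of each
edge, and distinct edges with a common endpoint receive disjoint sets. -/
def IsSetListEdgeColoring {α : Type w} (G : SimpleGraph V) (s : ℕ)
    (L φ : G.edgeSet → Finset α) : Prop :=
  (∀ e, φ e ⊆ L e ∧ (φ e).card = s) ∧
    ∀ e f : G.edgeSet, e ≠ f → (∃ v : V, v ∈ (e : Sym2 V) ∧ v ∈ (f : Sym2 V)) →
      Disjoint (φ e) (φ f)

/-- `G` is `(r, s)`-edge-choosable: every `r`-uniform list assignment on the edges, with colors in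
any type, admits an `s`-set coloring. -/
def IsEdgeChoosable (G : SimpleGraph V) (r s : ℕ) : Prop :=
  ∀ (α : Type w) (L : G.edgeSet → Finset α), (∀ e, (L e).card = r) →
    ∃ φ : G.edgeSet → Finset α, IsSetListEdgeColoring G s L φ

/-- A cycle of even length. The bound `3 ≤ n` excludes the degenerate `SimpleGraph.cycleGraph n`. -/
def IsEvenCycle (C : SimpleGraph V) : Prop :=
  ∃ n : ℕ, 3 ≤ n ∧ Even n ∧ Nonempty (C ≃g SimpleGraph.cycleGraph n)

/-- A double-star: a `6`-vertex tree having two adjacent vertices of degree `3`. -/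
def IsDoubleStar (T : SimpleGraph V) : Prop :=
  T.IsTree ∧ Nat.card V = 6 ∧
    ∃ x y : V, T.Adj x y ∧ (T.neighborSet x).ncard = 3 ∧ (T.neighborSet y).ncard = 3

/-- The vertices of degree `1` of a subgraph, that is, the leaves of its components. -/
def leaves {G : SimpleGraph V} (F : G.Subgraph) : Set V :=
  {v | v ∈ F.verts ∧ (F.neighborSet v).ncard = 1}

/-- `F` consists of independent double-stars in `G`: each component of `F` is a double-star, and
the leaves of all the components together form an independent set of `G`. -/
def ConsistsOfIndependentDoubleStars {G : SimpleGraph V} (F : G.Subgraph) : Prop :=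
  (∀ c : F.coe.ConnectedComponent, IsDoubleStar c.toSimpleGraph) ∧ G.IsIndepSet (leaves F)

/-- The subgraphs `G₁`, `G₂`, `G₃` form a MED decomposition of `G`: they partition the edges of
`G`, `G₁` is a matching, the components of `G₂` are even cycles, and `G₃` consists of independent
double-stars. -/
structure IsMEDDecomposition (G : SimpleGraph V) (G₁ G₂ G₃ : G.Subgraph) : Prop where
  edgeSet_union : G₁.edgeSet ∪ G₂.edgeSet ∪ G₃.edgeSet = G.edgeSet
  disjoint₁₂ : Disjoint G₁.edgeSet G₂.edgeSet
  disjoint₁₃ : Disjoint G₁.edgeSet G₃.edgeSet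
  disjoint₂₃ : Disjoint G₂.edgeSet G₃.edgeSet
  matching : G₁.IsMatching
  evenCycles : ∀ c : G₂.coe.ConnectedComponent, IsEvenCycle c.toSimpleGraph
  doubleStars : ConsistsOfIndependentDoubleStars G₃

/-- `G` has a MED decomposition. -/
def HasMEDDecomposition (G : SimpleGraph V) : Prop :=
  ∃ G₁ G₂ G₃ : G.Subgraph, IsMEDDecomposition G G₁ G₂ G₃

end MED

namespace MED

open Function

/-! Color the edges outside the even cycles first, so that each cycle edge loses at most 3 of its 7
colors. Four remain, and even cycles are (4,2)-edge-choosable (`exists_cycle_coloring`). The work is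
in the first stage, `Frame.exists_pendant_coloring`.

Split each cycle into alternating `b`-edges and `g`-edges. Every cycle vertex `v` has one further
edge, which goes to another cycle vertex or, if `v` is a leaf, to a center. Pair the two ends of the
former edges, and the two leaves at each center; the union of this pairing `t` with the `b`-edges is
bipartite. Hence there is a labeling `h` that is true at exactly one end of each `b`-edge, at one
end of each paired edge and at one leaf of each center, its tail; the other leaf is the head.

First colors `x` are chosen simultaneously by a chain argument (`exists_involutive_choice`), one for
each `t`-pair, a pair of leaves standing for its head's edge. They spend at most one color on each
`g`-edge without a tail, and the two heads of a double-star spend at most one color of the list of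
its central edge. Second colors settle the `b`-edges: the end where `h` is true keeps the loss at 2
before the other end adds its second color. A tail's pair is chosen after its cycle neighbors, which
independence makes non-leaves, and settles both of its cycle edges. The central edge then has 7 - 1
- 4 = 2 colors left, and a head's second color has only 5 colors to avoid. -/

/-! ### Alternating labelings for two involutions. -/

/-- The union of two perfect matchings has only even cycles and two-way infinite paths. With `σ = b
∘ t`, each component is the union of the `σ`-orbits of `v` and `b v`, which differ; `h` tells them
apart. -/
theorem exists_alternating_of_ne {X : Type*} {b t : X → X} (hb : Involutive b) (ht : Involutive t)
    (fb : ∀ v, b v ≠ v) (ft : ∀ v, t v ≠ v) :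
    ∃ h : X → Bool, ∀ v, h (b v) ≠ h v ∧ h (t v) ≠ h v := by
  classical
  let B : Equiv.Perm X := hb.toPerm
  let T : Equiv.Perm X := ht.toPerm
  have hB : B * B = 1 := Equiv.ext hb
  have hT : T * T = 1 := Equiv.ext ht
  have hB' : B⁻¹ = B := inv_eq_of_mul_eq_one_left hB
  have hT' : T⁻¹ = T := inv_eq_of_mul_eq_one_left hT
  let σ : Equiv.Perm X := B * T
  have hσ : σ⁻¹ = T * B := by simp only [σ, mul_inv_rev, hB', hT']
  have conjB : ∀ k : ℤ, B * σ ^ k = σ ^ (-k) * B := by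
    have h1 : B * σ * B⁻¹ = σ⁻¹ := by
      rw [hσ, hB']; simp only [σ, ← mul_assoc, hB, one_mul]
    intro k
    rw [zpow_neg, ← inv_zpow, ← h1, conj_zpow]; group
  have conjT : ∀ k : ℤ, T * σ ^ k = σ ^ (-k) * T := by
    have h1 : T * σ * T⁻¹ = σ⁻¹ := by
      rw [hσ, hT']; simp only [σ, mul_assoc, hT, mul_one]
    intro k
    rw [zpow_neg, ← inv_zpow, ← h1, conj_zpow]; group
  have hBT : ∀ v, T v = B (σ v) := fun v => by
    have : T = B * σ := by simp only [σ, ← mul_assoc, hB, one_mul]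
    exact congrArg (fun e : Equiv.Perm X => e v) this
  -- If `σ ^ k` took `v` to `b v`, the dihedral relations would make `σ ^ j v`, at the middle, a
  -- fixed point of `b` for `k = 2 * j` and of `t` for `k = 2 * j + 1`.
  have key : ∀ v, ¬ σ.SameCycle v (B v) := by
    rintro v ⟨k, hk⟩
    obtain ⟨j, hj | hj⟩ := Int.even_or_odd' k
    · apply fb ((σ ^ j) v)
      have h1 := congrArg (fun e : Equiv.Perm X => e v) (conjB j)
      simp only [Equiv.Perm.mul_apply, ← hk] at h1
      rw [← Equiv.Perm.mul_apply (σ ^ (-j)), ← zpow_add] at h1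
      rw [show -j + k = j by lia] at h1
      exact h1
    · apply ft ((σ ^ j) v)
      have h2 : T v = (σ ^ (2 * j)) v := by
        have h3 := hBT v
        rw [show B (σ v) = (B * σ ^ (1 : ℤ)) v by simp, conjB, Equiv.Perm.mul_apply, ← hk,
          ← Equiv.Perm.mul_apply, ← zpow_add] at h3
        rw [h3]; congr 2; lia
      have h1 := congrArg (fun e : Equiv.Perm X => e v) (conjT j)
      simp only [Equiv.Perm.mul_apply, h2] at h1
      rw [← Equiv.Perm.mul_apply (σ ^ (-j)), ← zpow_add] at h1
      rw [show -j + 2 * j = j by lia] at h1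
      exact h1
  let S := Equiv.Perm.SameCycle.setoid σ
  let q : X → Quotient S := Quotient.mk S
  have hq : ∀ {v w}, q v = q w ↔ σ.SameCycle v w := Quotient.eq
  have hqB : ∀ {v w}, q v = q w → q (B v) = q (B w) := by
    intro v w hvw
    obtain ⟨k, hk⟩ := hq.1 hvw
    refine hq.2 ⟨-k, ?_⟩
    rw [← hk]
    exact (congrArg (fun e : Equiv.Perm X => e v) (conjB k)).symm
  -- A well-order on the orbits selects one of the two orbits in each component.
  refine ⟨fun v => decide (WellOrderingRel (q v) (q (B v))), ?_⟩
  have flip : ∀ v w, q w = q (B v) →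
      decide (WellOrderingRel (q w) (q (B w))) ≠ decide (WellOrderingRel (q v) (q (B v))) := by
    intro v w hw
    have h2 : q (B w) = q v := by
      rw [hqB hw]; congr 1; exact hb v
    rw [hw, h2]
    intro h
    have hne : q v ≠ q (B v) := fun h => key v (hq.1 h)
    rcases trichotomous_of WellOrderingRel (q v) (q (B v)) with h' | h' | h'
    · have h3 : WellOrderingRel (q (B v)) (q v) := by simpa [h'] using h
      exact asymm h' h3
    · exact hne h'
    · have h3 : WellOrderingRel (q v) (q (B v)) := by simpa [h'] using h.symm
      exact asymm h' h3
  intro v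
  refine ⟨flip v _ rfl, flip v _ ?_⟩
  change q (T v) = _
  rw [hBT]
  exact hqB (hq.2 ⟨-1, by simp⟩)

/-- The map that exchanges the two copies of a fixed point of `b` and acts as `b` elsewhere. -/
noncomputable def unfix {X : Type*} (b : X → X) (v : X × Bool) : X × Bool :=
  open Classical in if b v.1 = v.1 then (v.1, !v.2) else (b v.1, v.2)

theorem unfix_involutive {X : Type*} {b : X → X} (hb : Involutive b) : Involutive (unfix b) := by
  rintro ⟨v, i⟩
  by_cases h : b v = v
  · simp [unfix, h]
  · have : ¬ v = b v := fun h' => h h'.symm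
    simp [unfix, h, hb v, this]

theorem unfix_ne {X : Type*} (b : X → X) (v : X × Bool) : unfix b v ≠ v := by
  obtain ⟨v, i⟩ := v
  by_cases h : b v = v <;> simp [unfix, h]

theorem unfix_fst {X : Type*} (b : X → X) (v : X × Bool) : (unfix b v).1 = b v.1 := by
  obtain ⟨v, i⟩ := v
  by_cases h : b v = v <;> simp [unfix, h]

theorem unfix_mk {X : Type*} {b : X → X} {v : X} (h : b v ≠ v) (i : Bool) :
    unfix b (v, i) = (b v, i) := by simp [unfix, h]

/-- Doubling `X` turns fixed points into swapped pairs and keeps other points in their copy, so a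
labeling of the double restricts to one copy. -/
theorem exists_alternating {X : Type*} {b t : X → X} (hb : Involutive b) (ht : Involutive t) :
    ∃ h : X → Bool, ∀ v, (b v ≠ v → h (b v) ≠ h v) ∧ (t v ≠ v → h (t v) ≠ h v) := by
  obtain ⟨h, hh⟩ := exists_alternating_of_ne (unfix_involutive hb) (unfix_involutive ht)
    (unfix_ne b) (unfix_ne t)
  refine ⟨fun v => h (v, false), fun v => ⟨fun hv => ?_, fun hv => ?_⟩⟩
  · simpa only [unfix_mk hv] using (hh (v, false)).1
  · simpa only [unfix_mk hv] using (hh (v, false)).2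

/-! ### Choosing colors along chains; even cycles with lists of size 4. -/

section Chain

variable {I : Type*} {α : Type w}

/-- A color of `T i` used at `i` can be repeated at `σ i` if it is in the list there; if not,
counting gives that list a color outside `T i`. So choices propagate in both directions, and only
closing up an orbit is a problem. If a list has a color outside an adjacent constraint set,
beginning there makes that constraint free; where no such beginning is available, consecutive lists
agree. -/
theorem exists_chain_choice (σ : Equiv.Perm I) {n : ℕ} (hn : 0 < n) (L T : I → Finset α)
    (hL : ∀ i, (L i).card = n) (hT : ∀ i, (T i).card ≤ n) :
    ∃ x : I → α, (∀ i, x i ∈ L i) ∧ ∀ i, x i ∉ T i ∨ x (σ i) ∉ T i ∨ x i = x (σ i) := by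
  classical
  have inv₁ : ∀ i, σ⁻¹ (σ i) = i := fun i => by simp
  have inv₂ : ∀ i, σ (σ⁻¹ i) = i := fun i => by simp
  have hne : ∀ i, (L i).Nonempty := fun i => Finset.card_pos.1 (by rw [hL]; exact hn)
  have esc : ∀ i j, ∀ c ∈ T j, c ∉ L i → ∃ d ∈ L i, d ∉ T j := by
    intro i j c hc hcL
    by_contra! hcon
    have : L i ⊆ (T j).erase c := fun d hd => Finset.mem_erase.2 ⟨fun h => hcL (h ▸ hd), hcon d hd⟩
    have := Finset.card_le_card this
    rw [Finset.card_erase_of_mem hc, hL] at this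
    have := hT j
    lia
  have fwd : ∀ i c, ∃ d ∈ L (σ i), c ∉ T i ∨ d ∉ T i ∨ c = d := by
    intro i c
    by_cases h1 : c ∈ T i
    · by_cases h2 : c ∈ L (σ i)
      · exact ⟨c, h2, Or.inr (Or.inr rfl)⟩
      · obtain ⟨d, hd, hd'⟩ := esc (σ i) i c h1 h2
        exact ⟨d, hd, Or.inr (Or.inl hd')⟩
    · obtain ⟨d, hd⟩ := hne (σ i)
      exact ⟨d, hd, Or.inl h1⟩
  have bwd : ∀ i c, ∃ d ∈ L i, d ∉ T i ∨ c ∉ T i ∨ d = c := by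
    intro i c
    by_cases h1 : c ∈ T i
    · by_cases h2 : c ∈ L i
      · exact ⟨c, h2, Or.inr (Or.inr rfl)⟩
      · obtain ⟨d, hd, hd'⟩ := esc i i c h1 h2
        exact ⟨d, hd, Or.inl hd'⟩
    · obtain ⟨d, hd⟩ := hne i
      exact ⟨d, hd, Or.inr (Or.inl h1)⟩
  choose F hFL hF using fwd
  choose B hBL hB using bwd
  rcases isEmpty_or_nonempty I with hI | ⟨⟨i₀⟩⟩
  · exact ⟨fun i => hI.elim i, fun i => hI.elim i, fun i => hI.elim i⟩
  -- At a `start` the constraint behind can be met whatever the previous choice; at a `last`, the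
  -- constraint ahead.
  let start : I → Prop := fun i => ∃ d ∈ L i, d ∉ T (σ⁻¹ i)
  let last : I → Prop := fun i => ∃ d ∈ L i, d ∉ T i
  obtain ⟨s, hsL, hs⟩ : ∃ s : I → α, (∀ i, s i ∈ L i) ∧ ∀ i, start i → s i ∉ T (σ⁻¹ i) := by
    refine ⟨fun i => if h : start i then h.choose else (hne i).choose, fun i => ?_, fun i h => ?_⟩
    · by_cases h : start i
      · simp only [dif_pos h]; exact h.choose_spec.1
      · simp only [dif_neg h]; exact (hne i).choose_spec
    · simp only [dif_pos h]; exact h.choose_spec.2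
  obtain ⟨e, heL, he⟩ : ∃ e : I → α, (∀ i, e i ∈ L i) ∧ ∀ i, last i → e i ∉ T i := by
    refine ⟨fun i => if h : last i then h.choose else (hne i).choose, fun i => ?_, fun i h => ?_⟩
    · by_cases h : last i
      · simp only [dif_pos h]; exact h.choose_spec.1
      · simp only [dif_neg h]; exact (hne i).choose_spec
    · simp only [dif_pos h]; exact h.choose_spec.2
  -- The choice depends on the list alone, so equal lists receive equal colors.
  obtain ⟨z, hz⟩ : ∃ z : Finset α → α, ∀ i, z (L i) ∈ L i := by
    refine ⟨fun S => if h : S.Nonempty then h.choose else (hne i₀).choose, fun i => ?_⟩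
    simp only [dif_pos (hne i)]; exact (hne i).choose_spec
  let X : ℕ → I → α := fun k => Nat.rec s (fun _ f i => F (σ⁻¹ i) (f (σ⁻¹ i))) k
  let Y : ℕ → I → α := fun k => Nat.rec e (fun _ f i => B i (f (σ i))) k
  have hXL : ∀ k i, X k i ∈ L i := by
    rintro (_ | k) i
    · exact hsL i
    · have := hFL (σ⁻¹ i) (X k (σ⁻¹ i))
      rwa [inv₂] at this
  have hYL : ∀ k i, Y k i ∈ L i := by
    rintro (_ | k) i
    · exact heL i
    · exact hBL i (Y k (σ i))
  -- Propagation runs forward from the nearest `start` at or behind `i`, failing that backward from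
  -- the nearest `last` at or ahead of `i`.
  let P : I → Prop := fun i => ∃ k : ℕ, start ((σ⁻¹ ^ k) i)
  let Q : I → Prop := fun i => ∃ k : ℕ, last ((σ ^ k) i)
  refine ⟨fun i => if h : P i then X (Nat.find h) i else if h : Q i then Y (Nat.find h) i
    else z (L i), fun i => ?_, fun i => ?_⟩
  · dsimp only
    split_ifs
    exacts [hXL _ _, hYL _ _, hz i]
  have hpow : ∀ k : ℕ, (σ⁻¹ ^ (k + 1)) (σ i) = (σ⁻¹ ^ k) i := fun k => by
    rw [pow_succ, Equiv.Perm.mul_apply, inv₁]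
  have hpow' : ∀ k : ℕ, (σ ^ (k + 1)) i = (σ ^ k) (σ i) := fun k => by
    rw [pow_succ, Equiv.Perm.mul_apply]
  have hP : P i → P (σ i) := fun ⟨k, hk⟩ => ⟨k + 1, by rwa [hpow]⟩
  have hQ : Q (σ i) → Q i := fun ⟨k, hk⟩ => ⟨k + 1, by rwa [hpow']⟩
  by_cases hst : start (σ i)
  · have hPσ : P (σ i) := ⟨0, hst⟩
    have h0 : Nat.find hPσ = 0 := (Nat.find_eq_zero hPσ).2 hst
    refine Or.inr (Or.inl ?_)
    simp only [dif_pos hPσ, h0]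
    have := hs _ hst
    rwa [inv₁] at this
  by_cases hPi : P i
  · have hPσ := hP hPi
    have hf : Nat.find hPσ = Nat.find hPi + 1 := by
      rw [Nat.find_eq_iff]
      refine ⟨by rw [hpow]; exact Nat.find_spec hPi, ?_⟩
      rintro (_ | m) hm
      · exact hst
      · rw [hpow]; exact Nat.find_min hPi (by lia)
    simp only [dif_pos hPσ, dif_pos hPi, hf]
    have := hF i (X (Nat.find hPi) i)
    simpa only [X, inv₁] using this
  have hPσ : ¬ P (σ i) := by
    rintro ⟨_ | k, hk⟩
    · exact hst hk
    · exact hPi ⟨k, by rwa [hpow] at hk⟩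
  simp only [dif_neg hPσ, dif_neg hPi]
  by_cases hl : last i
  · have hQi : Q i := ⟨0, hl⟩
    have h0 : Nat.find hQi = 0 := (Nat.find_eq_zero hQi).2 hl
    refine Or.inl ?_
    simp only [dif_pos hQi, h0]
    exact he _ hl
  by_cases hQi : Q i
  · have hQσ : Q (σ i) := by
      obtain ⟨_ | k, hk⟩ := hQi
      · exact absurd hk hl
      · exact ⟨k, by rwa [hpow'] at hk⟩
    have hf : Nat.find hQi = Nat.find hQσ + 1 := by
      rw [Nat.find_eq_iff]
      refine ⟨by rw [hpow']; exact Nat.find_spec hQσ, ?_⟩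
      rintro (_ | m) hm
      · exact hl
      · rw [hpow']; exact Nat.find_min hQσ (by lia)
    simp only [dif_pos hQσ, dif_pos hQi, hf]
    exact hB i (Y (Nat.find hQσ) (σ i))
  have hQσ : ¬ Q (σ i) := fun h => hQi (hQ h)
  refine Or.inr (Or.inr ?_)
  simp only [dif_neg hQσ, dif_neg hQi]
  have h1 : L i ⊆ T i := fun d hd => by_contra fun h => hl ⟨d, hd, h⟩
  have h2 : L (σ i) ⊆ T i := fun d hd => by_contra fun h =>
    hst ⟨d, hd, by rwa [inv₁]⟩
  rw [Finset.eq_of_subset_of_card_le h1 (by rw [hL]; exact hT i),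
    Finset.eq_of_subset_of_card_le h2 (by rw [hL]; exact hT i)]

/-- The items are the orbits of `t`, each with a list of `n` colors; the orbits of `g` are
constraints, which ask that the two items met by the orbit use at most one color of a given set of
at most `n` colors. -/
theorem exists_involutive_choice {X : Type*} {t g : X → X} (ht : Involutive t) (hg : Involutive g)
    {n : ℕ} (hn : 0 < n) (L T : X → Finset α) (hL : ∀ v, (L v).card = n)
    (hT : ∀ v, (T v).card ≤ n) (hLt : ∀ v, L (t v) = L v) (hTg : ∀ v, T (g v) = T v) :
    ∃ x : X → α, (∀ v, x v ∈ L v) ∧ (∀ v, x (t v) = x v) ∧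
      ∀ v, x v ∉ T v ∨ x (g v) ∉ T v ∨ x v = x (g v) := by
  obtain ⟨h, hh⟩ := exists_alternating_of_ne (unfix_involutive hg) (unfix_involutive ht)
    (unfix_ne g) (unfix_ne t)
  have flip : ∀ {a b : Bool}, a ≠ b → (a = true ↔ b = false) := by decide
  -- Each orbit of `unfix t` has exactly one point where `h` is true, so `I` represents the items,
  -- and `σ` passes to the item that shares a constraint.
  let I := {v : X × Bool // h v = true}
  have h₁ : ∀ v : X × Bool, h v = true → h (unfix t (unfix g v)) = true := fun v hv =>
    (flip (hh _).2).2 (by have := (hh v).1; rw [hv] at this; simpa using this)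
  have h₂ : ∀ v : X × Bool, h v = true → h (unfix g (unfix t v)) = true := fun v hv =>
    (flip (hh _).1).2 (by have := (hh v).2; rw [hv] at this; simpa using this)
  let σ : Equiv.Perm I :=
    { toFun := fun v => ⟨unfix t (unfix g v.1), h₁ _ v.2⟩
      invFun := fun v => ⟨unfix g (unfix t v.1), h₂ _ v.2⟩
      left_inv := fun v => Subtype.ext (by
        simp only [unfix_involutive ht (unfix g v.1), unfix_involutive hg v.1])
      right_inv := fun v => Subtype.ext (by
        simp only [unfix_involutive hg (unfix t v.1), unfix_involutive ht v.1]) }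
  obtain ⟨x, hxL, hx⟩ := exists_chain_choice σ hn (fun v => L v.1.1) (fun v => T v.1.1)
    (fun _ => hL _) (fun _ => hT _)
  have h₃ : ∀ v : X × Bool, ¬ h v = true → h (unfix t v) = true := fun v hv =>
    (flip (hh _).2).2 (by simpa using hv)
  let y : X × Bool → α := fun v => if hv : h v = true then x ⟨v, hv⟩ else x ⟨unfix t v, h₃ v hv⟩
  have hyt : ∀ v, y (unfix t v) = y v := fun v => by
    by_cases hv : h v = true
    · have : ¬ h (unfix t v) = true := fun h' => (hh v).2 (h'.trans hv.symm)
      simp only [y, dif_pos hv, dif_neg this, unfix_involutive ht v]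
    · simp only [y, dif_neg hv, dif_pos (h₃ v hv)]
  have hyL : ∀ v, y v ∈ L v.1 := fun v => by
    by_cases hv : h v = true
    · simp only [y, dif_pos hv]; exact hxL _
    · simp only [y, dif_neg hv]
      have := hxL ⟨unfix t v, h₃ v hv⟩
      simpa only [unfix_fst, hLt] using this
  have hy : ∀ v, h v = true → y v ∉ T v.1 ∨ y (unfix g v) ∉ T v.1 ∨ y v = y (unfix g v) := by
    intro v hv
    have h1 := hx ⟨v, hv⟩
    have h2 : y (unfix g v) = x (σ ⟨v, hv⟩) := by
      rw [← hyt]; simp only [y, dif_pos (h₁ v hv)]; rfl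
    rw [h2]
    simpa only [y, dif_pos hv] using h1
  have hy' : ∀ v, y v ∉ T v.1 ∨ y (unfix g v) ∉ T v.1 ∨ y v = y (unfix g v) := by
    intro v
    by_cases hv : h v = true
    · exact hy v hv
    · have := hy (unfix g v) ((flip (hh v).1).2 (by simpa using hv))
      rw [unfix_involutive hg v, unfix_fst, hTg] at this
      tauto
  refine ⟨fun v => y (v, false), fun v => hyL _, fun v => ?_, fun v => ?_⟩
  · by_cases hv : t v = v
    · rw [hv]
    · change y (t v, false) = y (v, false)
      rw [← unfix_mk hv, hyt]
  · by_cases hv : g v = v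
    · exact Or.inr (Or.inr (by rw [hv]))
    · have := hy' (v, false)
      rwa [unfix_mk hv] at this

/-- Each of two rounds of choices spends at most one color of `T`, except that the second may spend
two if the first spends none. -/
theorem card_inter_le_two [DecidableEq α] {T : Finset α} {x x' y y' : α}
    (h₁ : x ∉ T ∨ x' ∉ T ∨ x = x')
    (h₂ : x ∈ T ∨ x' ∈ T → y ∉ T \ {x, x'} ∨ y' ∉ T \ {x, x'} ∨ y = y') :
    (T ∩ {x, y, x', y'}).card ≤ 2 := by
  have key : ∀ c d, (∀ u ∈ T, u = x ∨ u = y ∨ u = x' ∨ u = y' → u = c ∨ u = d) →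
      (T ∩ {x, y, x', y'}).card ≤ 2 := fun c d h =>
    (Finset.card_le_card (t := {c, d}) fun u hu => by
      simp only [Finset.mem_inter, Finset.mem_insert, Finset.mem_singleton] at hu ⊢
      exact h u hu.1 hu.2).trans Finset.card_le_two
  by_cases h : x ∈ T ∨ x' ∈ T
  · have h₂ := h₂ h
    simp only [Finset.mem_sdiff, Finset.mem_insert, Finset.mem_singleton] at h₂
    by_cases hx : x ∈ T <;> by_cases hy : y ∈ T ∧ ¬ (y = x ∨ y = x')
    · exact key x y (by grind)
    · exact key x y' (by grind)
    · exact key x' y (by grind)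
    · exact key x' y' (by grind)
  · exact key y y' (by grind)

/-- Give each `g`-edge two colors in two rounds of `exists_involutive_choice`, with the `b`-edges as
constraints, so that a `b`-edge loses at most 2 of 4 colors and keeps 2 for itself. -/
theorem exists_cycle_coloring {X : Type*} {b g : X → X} (hb : Involutive b) (hg : Involutive g)
    (B C : X → Finset α) (hB : ∀ v, 4 ≤ (B v).card) (hC : ∀ v, 4 ≤ (C v).card)
    (hBb : ∀ v, B (b v) = B v) (hCg : ∀ v, C (g v) = C v) :
    ∃ φ ψ : X → Finset α, (∀ v, φ v ⊆ B v ∧ (φ v).card = 2 ∧ φ (b v) = φ v) ∧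
      (∀ v, ψ v ⊆ C v ∧ (ψ v).card = 2 ∧ ψ (g v) = ψ v) ∧ ∀ v, Disjoint (φ v) (ψ v) := by
  classical
  -- A selection that depends only on the set inherits the invariance of the lists under `b` and
  -- `g`.
  have pick : ∀ (n : ℕ) (S : Finset α), ∃ R ⊆ S, n ≤ S.card → R.card = n := fun n S => by
    by_cases h : n ≤ S.card
    · obtain ⟨R, h1, h2⟩ := Finset.exists_subset_card_eq h
      exact ⟨R, h1, fun _ => h2⟩
    · exact ⟨∅, by simp, fun h' => absurd h' h⟩
  choose pk hpk hpk' using pick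
  let T : X → Finset α := fun v => pk 4 (B v)
  let L : X → Finset α := fun v => pk 4 (C v)
  have hT : ∀ v, (T v).card = 4 := fun v => hpk' 4 _ (hB v)
  have hL : ∀ v, (L v).card = 4 := fun v => hpk' 4 _ (hC v)
  have hTb : ∀ v, T (b v) = T v := fun v => by simp only [T, hBb]
  have hLg : ∀ v, L (g v) = L v := fun v => by simp only [L, hCg]
  obtain ⟨x, hxL, hxg, hx⟩ := exists_involutive_choice hg hb (by norm_num) L T hL
    (fun v => (hT v).le) hLg hTb
  -- The second round has lists of size 3, so its constraint sets must have at most 3 elements. If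
  -- the first round missed `T v`, no constraint is needed.
  let T' : X → Finset α := fun v =>
    if x v ∈ T v ∨ x (b v) ∈ T v then T v \ {x v, x (b v)} else ∅
  have hT' : ∀ v, (T' v).card ≤ 3 := fun v => by
    by_cases h : x v ∈ T v ∨ x (b v) ∈ T v
    · simp only [T', if_pos h]
      have : T v \ {x v, x (b v)} ⊂ T v := by
        refine Finset.ssubset_iff_subset_ne.2 ⟨Finset.sdiff_subset, fun he => ?_⟩
        rw [Finset.sdiff_eq_self_iff_disjoint, Finset.disjoint_right] at he
        rcases h with h | h
        · exact he (by simp) h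
        · exact he (by simp) h
      have := Finset.card_lt_card this
      rw [hT] at this
      lia
    · simp [T', if_neg h]
  obtain ⟨y, hyL, hyg, hy⟩ := exists_involutive_choice hg hb (n := 3) (by norm_num)
    (fun v => (L v).erase (x v)) T' (fun v => by rw [Finset.card_erase_of_mem (hxL v), hL]) hT'
    (fun v => by simp only [hLg, hxg])
    (fun v => by simp only [T', hTb, hb v, or_comm, Finset.pair_comm])
  have hyx : ∀ v, y v ∈ L v ∧ y v ≠ x v := fun v =>
    ⟨Finset.mem_of_mem_erase (hyL v), Finset.ne_of_mem_erase (hyL v)⟩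
  let R : X → Finset α := fun v => T v \ {x v, y v, x (b v), y (b v)}
  have hR : ∀ v, 2 ≤ (R v).card := by
    intro v
    have h := card_inter_le_two (hx v) (fun h => by simpa only [T', if_pos h] using hy v)
    have := Finset.card_sdiff_add_card_inter (T v) {x v, y v, x (b v), y (b v)}
    rw [hT] at this
    simp only [R]; lia
  refine ⟨fun v => pk 2 (R v), fun v => {x v, y v}, fun v => ⟨?_, hpk' 2 _ (hR v), ?_⟩,
    fun v => ⟨?_, Finset.card_pair (hyx v).2.symm, by simp only [hxg, hyg]⟩, fun v => ?_⟩
  · exact ((hpk _ _).trans Finset.sdiff_subset).trans (hpk _ _)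
  · suffices R (b v) = R v by simp only [this]
    ext u
    simp only [R, hTb, hb v, Finset.mem_sdiff, Finset.mem_insert, Finset.mem_singleton]
    tauto
  · refine Finset.Subset.trans ?_ (hpk 4 (C v))
    intro u hu
    rcases Finset.mem_insert.1 hu with rfl | hu
    · exact hxL v
    · rw [Finset.mem_singleton.1 hu]; exact (hyx v).1
  · refine Finset.disjoint_of_subset_left (hpk _ _) ?_
    rw [Finset.disjoint_left]
    intro u hu
    simp only [R, Finset.mem_sdiff, Finset.mem_insert, Finset.mem_singleton] at hu ⊢
    tauto

end Chain

/-! ### The decomposition in terms of involutions. -/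

/-- A combinatorial description of a cubic graph with a MED decomposition. The set `W` consists of
the vertices on the even cycles, and its complement of the centers of the double-stars. A vertex of
`W` has two neighbors `b v` and `g v` along its cycle, such that the edges of the cycles at `b` and
at `g` alternate, and a third neighbor `p v`, which lies in `W` or is the center next to the leaf
`v`. The neighbor `p v` of a center is the other center of its double-star. The involution `t` is
`p` at a non-leaf of `W`, and sends a leaf to the other leaf with the same center. -/
structure Frame {V : Type u} (G : SimpleGraph V) (W : Set V) (b g p t : V → V) : Prop where
  b_inv : Involutive b
  g_inv : Involutive g
  t_inv : Involutive t
  b_mem : ∀ v ∈ W, b v ∈ W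
  g_mem : ∀ v ∈ W, g v ∈ W
  b_off : ∀ v ∉ W, b v = v
  g_off : ∀ v ∉ W, g v = v
  t_off : ∀ v ∉ W, t v = v
  adj_iff : ∀ v ∈ W, ∀ w, G.Adj v w ↔ w = b v ∨ w = g v ∨ w = p v
  b_ne_g : ∀ v ∈ W, b v ≠ g v
  b_ne_p : ∀ v ∈ W, b v ≠ p v
  g_ne_p : ∀ v ∈ W, g v ≠ p v
  p_p : ∀ v ∈ W, p v ∈ W → p (p v) = v
  t_eq_p : ∀ v ∈ W, p v ∈ W → t v = p v
  t_leaf : ∀ v ∈ W, p v ∉ W → t v ∈ W ∧ t v ≠ v ∧ p (t v) = p v ∧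
    ∀ w ∈ W, p w = p v → w = v ∨ w = t v
  p_center : ∀ v ∉ W, p v ∉ W ∧ p (p v) = v ∧ G.Adj v (p v)
  center_adj : ∀ v ∉ W, ∀ w ∉ W, G.Adj v w → w = p v
  exists_leaf : ∀ v ∉ W, ∃ a ∈ W, p a = v
  indep : ∀ v ∈ W, p v ∉ W → p (b v) ∈ W ∧ p (g v) ∈ W

/-! ### Choices at a single edge. -/

section Choice

variable {α : Type w} [DecidableEq α]

/-- Only distinct `x, x' ∈ B` matter: then `x'` is repeated if it lies in `L`, and otherwise
counting gives a color of `L` outside `B`. -/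
theorem exists_second_color {L B : Finset α} (hLB : B.card ≤ L.card) (hL : 2 ≤ L.card) (x x' : α) :
    ∃ y ∈ L, y ≠ x ∧ (B ∩ {x, x', y}).card ≤ 2 := by
  by_cases h : x ∈ B ∧ x' ∈ B ∧ x ≠ x'
  · obtain ⟨hx, hx', hne⟩ := h
    by_cases hL' : x' ∈ L
    · refine ⟨x', hL', hne.symm, (Finset.card_le_card Finset.inter_subset_right).trans ?_⟩
      rw [Finset.insert_eq_of_mem (s := {x'}) (by simp)]
      exact Finset.card_le_two
    · obtain ⟨y, hy, hyB⟩ : ∃ y ∈ L, y ∉ B := by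
        by_contra! hcon
        have := Finset.card_le_card (fun y hy => Finset.mem_erase.2
          ⟨fun h => hL' (h ▸ hy), hcon y hy⟩ : L ⊆ B.erase x')
        rw [Finset.card_erase_of_mem hx'] at this
        have := Finset.card_pos.2 ⟨x', hx'⟩
        lia
      refine ⟨y, hy, fun h => hyB (h ▸ hx), (Finset.card_le_card (t := {x, x'}) ?_).trans
        Finset.card_le_two⟩
      intro u hu
      simp only [Finset.mem_inter, Finset.mem_insert, Finset.mem_singleton] at hu ⊢
      grind
  · obtain ⟨y, hy⟩ : (L.erase x).Nonempty := by
      rw [← Finset.card_pos]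
      have := Finset.pred_card_le_card_erase (s := L) (a := x)
      lia
    refine ⟨y, Finset.mem_of_mem_erase hy, Finset.ne_of_mem_erase hy, ?_⟩
    have key : ∀ c, (∀ u ∈ B, u = x ∨ u = x' ∨ u = y → u = c ∨ u = y) →
        (B ∩ {x, x', y}).card ≤ 2 := fun c h =>
      (Finset.card_le_card (t := {c, y}) fun u hu => by
        simp only [Finset.mem_inter, Finset.mem_insert, Finset.mem_singleton] at hu ⊢
        exact h u hu.1 hu.2).trans Finset.card_le_two
    by_cases hx : x ∈ B
    · exact key x (by grind)
    · exact key x' (by grind)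

/-- A color that is not in the part of `B` left over by the pair `φ`, unless `φ` leaves over almost
all of `B`. -/
theorem exists_cheap_color {L B φ : Finset α} (hL : L.card = 7) (hB : B.card = 7)
    (hφ : φ.card = 2) (a : α) : ∃ y ∈ L, y ≠ a ∧ (B ∩ (φ ∪ {y})).card ≤ 2 := by
  have hcard : 6 ≤ (L.erase a).card := by
    have := Finset.pred_card_le_card_erase (s := L) (a := a)
    lia
  by_cases h : (B ∩ φ).card ≤ 1
  · obtain ⟨y, hy⟩ : (L.erase a).Nonempty := by rw [← Finset.card_pos]; lia
    refine ⟨y, Finset.mem_of_mem_erase hy, Finset.ne_of_mem_erase hy, ?_⟩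
    rw [Finset.inter_union_distrib_left]
    have h1 := Finset.card_union_le (B ∩ φ) (B ∩ {y})
    have h2 := Finset.card_le_card (Finset.inter_subset_right : B ∩ {y} ⊆ {y})
    rw [Finset.card_singleton] at h2
    lia
  -- Here both colors of `φ` lie in `B`, so `B \ φ` has 5 elements and cannot cover the at least 6
  -- of `L.erase a`.
  · obtain ⟨y, hy⟩ : (L.erase a \ (B \ φ)).Nonempty := by
      rw [← Finset.card_pos]
      have := Finset.card_sdiff_add_card_inter B φ
      have := Finset.le_card_sdiff (B \ φ) (L.erase a)
      lia
    rw [Finset.mem_sdiff, Finset.mem_erase] at hy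
    refine ⟨y, hy.1.2, hy.1.1, (Finset.card_le_card (t := φ) ?_).trans hφ.le⟩
    intro u hu
    simp only [Finset.mem_inter, Finset.mem_union, Finset.mem_singleton, Finset.mem_sdiff] at hu hy
    grind

/-- One color of `θ` is cheap for `B` and one for `C`; with `φ` or `ψ` it costs at most 2, and the
other color at most 1 more. -/
theorem exists_pair_of_leaf {L B C φ ψ : Finset α} (hL : L.card = 7) (hB : B.card = 7)
    (hC : C.card = 7) (hφ : φ.card = 2) (hψ : ψ.card = 2) (a : α) :
    ∃ θ ⊆ L, θ.card = 2 ∧ a ∉ θ ∧ (B ∩ (θ ∪ φ)).card ≤ 3 ∧ (C ∩ (θ ∪ ψ)).card ≤ 3 := by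
  obtain ⟨y, hy, hya, hyB⟩ := exists_cheap_color hL hB hφ a
  obtain ⟨z, hz, hza, hzC⟩ := exists_cheap_color hL hC hψ a
  obtain ⟨θ, h1, h2, h3⟩ : ∃ θ, {y, z} ⊆ θ ∧ θ ⊆ L.erase a ∧ θ.card = 2 := by
    refine Finset.exists_subsuperset_card_eq ?_ Finset.card_le_two ?_
    · intro u hu
      rcases Finset.mem_insert.1 hu with rfl | hu
      · exact Finset.mem_erase.2 ⟨hya, hy⟩
      · rw [Finset.mem_singleton.1 hu]; exact Finset.mem_erase.2 ⟨hza, hz⟩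
    · have := Finset.pred_card_le_card_erase (s := L) (a := a)
      lia
  have key : ∀ (D χ : Finset α) (u : α), u ∈ θ → (D ∩ (χ ∪ {u})).card ≤ 2 →
      (D ∩ (θ ∪ χ)).card ≤ 3 := by
    intro D χ u hu hD
    have h4 : D ∩ (θ ∪ χ) ⊆ D ∩ (χ ∪ {u}) ∪ θ.erase u := by
      intro v hv
      simp only [Finset.mem_inter, Finset.mem_union, Finset.mem_singleton, Finset.mem_erase]
        at hv ⊢
      tauto
    have h5 := (Finset.card_le_card h4).trans (Finset.card_union_le _ _)
    rw [Finset.card_erase_of_mem hu] at h5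
    lia
  exact ⟨θ, h2.trans (Finset.erase_subset _ _), h3, fun ha => Finset.notMem_erase a L (h2 ha),
    key B φ y (h1 (by simp)) hyB, key C ψ z (h1 (by simp)) hzC⟩

end Choice

/-! ### Coloring the edges outside the cycles. -/

namespace Frame

variable {V : Type u} {G : SimpleGraph V} {W : Set V} {b g p t : V → V} {α : Type w}

theorem b_ne (F : Frame G W b g p t) {v : V} (hv : v ∈ W) : b v ≠ v := fun h =>
  G.ne_of_adj ((F.adj_iff v hv (b v)).2 (Or.inl rfl)) h.symm

theorem p_ne (F : Frame G W b g p t) {v : V} (hv : v ∈ W) : p v ≠ v := fun h =>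
  G.ne_of_adj ((F.adj_iff v hv (p v)).2 (Or.inr (Or.inr rfl))) h.symm

/-- The colors of the edges outside the even cycles can be chosen such that at least four colors
remain for each edge of a cycle. -/
theorem exists_pendant_coloring [DecidableEq α] (F : Frame G W b g p t) (P B C : V → Finset α)
    (hP : ∀ v, (P v).card = 7) (hB : ∀ v ∈ W, (B v).card = 7) (hC : ∀ v ∈ W, (C v).card = 7)
    (hPp : ∀ v, (v ∈ W ↔ p v ∈ W) → P (p v) = P v) (hBb : ∀ v ∈ W, B (b v) = B v)
    (hCg : ∀ v ∈ W, C (g v) = C v) :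
    ∃ φ : V → Finset α, (∀ v, φ v ⊆ P v ∧ (φ v).card = 2) ∧
      (∀ v, (v ∈ W ↔ p v ∈ W) → φ (p v) = φ v) ∧
      (∀ v ∈ W, p v ∉ W → Disjoint (φ v) (φ (t v)) ∧ Disjoint (φ v) (φ (p v))) ∧
      ∀ v ∈ W, (B v ∩ (φ v ∪ φ (b v))).card ≤ 3 ∧ (C v ∩ (φ v ∪ φ (g v))).card ≤ 3 := by
  classical
  obtain ⟨h, hh⟩ := exists_alternating F.b_inv F.t_inv
  have flip : ∀ {a b : Bool}, a ≠ b → (a = true ↔ ¬ b = true) := by decide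
  have hb : ∀ v ∈ W, (h (b v) = true ↔ ¬ h v = true) := fun v hv => flip ((hh v).1 (F.b_ne hv))
  have ht : ∀ v ∈ W, (h (t v) = true ↔ ¬ h v = true) := fun v hv => by
    refine flip ((hh v).2 ?_)
    by_cases hp : p v ∈ W
    · rw [F.t_eq_p v hv hp]; exact F.p_ne hv
    · exact (F.t_leaf v hv hp).2.1
  -- Each center has two leaves, exactly one of which is a tail.
  let tail : V → Prop := fun v => v ∈ W ∧ p v ∉ W ∧ h v = true
  have htail_t : ∀ v ∈ W, p v ∉ W → (tail (t v) ↔ ¬ tail v) := by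
    intro v hv hp
    obtain ⟨h1, h2, h3, -⟩ := F.t_leaf v hv hp
    simp only [tail, h1, h3, hp, hv, ht v hv, not_false_eq_true, true_and]
  have tail_unique : ∀ v w, tail v → tail w → p w = p v → w = v := by
    rintro v w hv hw hvw
    rcases (F.t_leaf v hv.1 hv.2.1).2.2.2 w hw.1 hvw with h1 | h1
    · exact h1
    · rw [h1] at hw
      exact absurd hv ((htail_t v hv.1 hv.2.1).1 hw)
  have exists_tail : ∀ z, ∃ v, z ∉ W → tail v ∧ p v = z := by
    intro z
    by_cases hz : z ∈ W
    · exact ⟨z, fun h => absurd hz h⟩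
    obtain ⟨a, ha, rfl⟩ := F.exists_leaf z hz
    by_cases h1 : tail a
    · exact ⟨a, fun _ => ⟨h1, rfl⟩⟩
    · exact ⟨t a, fun _ => ⟨(htail_t a ha hz).2 h1, (F.t_leaf a ha hz).2.2.1⟩⟩
  choose τ hτ using exists_tail
  -- Tails are detached from their `g`-edges, and the freed slot joins the tails of the two centers
  -- of a double-star. The other end of such a `g`-edge becomes a fixed point, with a vacuous
  -- constraint.
  let g' : V → V := fun v => if tail v then τ (p (p v)) else if tail (g v) then v else g v
  have hg'tail : ∀ v, tail v → tail (g' v) ∧ p (g' v) = p (p v) := fun v hv => by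
    simp only [g', if_pos hv]
    exact hτ _ (F.p_center _ hv.2.1).1
  have hg' : Involutive g' := by
    intro v
    by_cases hv : tail v
    · obtain ⟨h1, h2⟩ := hg'tail v hv
      obtain ⟨h3, h4⟩ := hg'tail _ h1
      exact tail_unique _ _ hv h3 (by rw [h4, h2, (F.p_center _ hv.2.1).2.1])
    · by_cases h1 : tail (g v)
      · have : g' v = v := by simp only [g', if_neg hv, if_pos h1]
        rw [this, this]
      · have : g' v = g v := by simp only [g', if_neg hv, if_neg h1]
        rw [this]
        simp only [g', if_neg h1, F.g_inv v, if_neg hv]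
  -- At a tail, `x` is the first color of the head at the same center, hence the head's list. The
  -- constraint between two tails thus concerns the two heads and the central edge.
  let L : V → Finset α := fun v => if tail v then P (t v) else P v
  let T : V → Finset α := fun v => if tail v then P (p v) else if v ∈ W then C v else ∅
  have hLt : ∀ v, L (t v) = L v := by
    intro v
    by_cases hv : v ∈ W
    · by_cases hp : p v ∈ W
      · have h1 : ¬ tail v := fun h => h.2.1 hp
        have h2 : ¬ tail (t v) := fun h => h.2.1 (by rwa [F.t_eq_p v hv hp, F.p_p v hv hp])
        simp only [L, if_neg h1, if_neg h2]
        rw [F.t_eq_p v hv hp, hPp v (by simp [hv, hp])]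
      · have h1 := htail_t v hv hp
        by_cases h2 : tail v
        · simp only [L, if_pos h2, if_neg (fun h => h1.1 h h2)]
        · simp only [L, if_neg h2, if_pos (h1.2 h2), F.t_inv v]
    · rw [F.t_off v hv]
  have hTg : ∀ v, T (g' v) = T v := by
    intro v
    by_cases hv : tail v
    · obtain ⟨h1, h2⟩ := hg'tail v hv
      simp only [T, if_pos hv, if_pos h1, h2]
      exact hPp _ (by simp [hv.2.1, (F.p_center _ hv.2.1).1])
    · by_cases h1 : tail (g v)
      · have : g' v = v := by simp only [g', if_neg hv, if_pos h1]
        rw [this]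
      · have : g' v = g v := by simp only [g', if_neg hv, if_neg h1]
        rw [this]
        by_cases hw : v ∈ W
        · simp only [T, if_neg hv, if_neg h1, if_pos hw, if_pos (F.g_mem v hw), hCg v hw]
        · rw [F.g_off v hw]
  obtain ⟨x, hxL, hxt, hx⟩ := exists_involutive_choice F.t_inv hg' (n := 7) (by norm_num) L T
    (fun v => by simp only [L]; split_ifs <;> exact hP _)
    (fun v => by
      simp only [T]; split_ifs with h1 h2
      exacts [(hP _).le, (hC v h2).le, by simp]) hLt hTg
  have hxP : ∀ v, ¬ tail v → x v ∈ P v := fun v hv => by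
    have := hxL v
    simpa only [L, if_neg hv] using this
  have hx₂ : ∀ v ∈ W, ¬ tail v → ¬ tail (g v) → x v ∉ C v ∨ x (g v) ∉ C v ∨ x v = x (g v) := by
    intro v hv h1 h2
    have := hx v
    simpa only [T, g', if_neg h1, if_neg h2, if_pos hv] using this
  -- The second colors of the edges between vertices of `W`.
  have hy : ∀ v, ∃ y ∈ P v, y ≠ x v ∧ (v ∈ W → (B v ∩ {x v, x (b v), y}).card ≤ 2) := by
    intro v
    by_cases hv : v ∈ W
    · obtain ⟨y, h1, h2, h3⟩ := exists_second_color (L := P v) (B := B v)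
        (by rw [hP, hB v hv]) (by rw [hP]; norm_num) (x v) (x (b v))
      exact ⟨y, h1, h2, fun _ => h3⟩
    · obtain ⟨y, h1, h2, h3⟩ := exists_second_color (L := P v) (B := ∅)
        (by simp) (by rw [hP]; norm_num) (x v) (x (b v))
      exact ⟨y, h1, h2, fun h => absurd h hv⟩
  choose y₀ hy₀P hy₀x hy₀ using hy
  -- Exactly one end of an edge inside `W` has `h` true, and the `b`-edge at that end determines the
  -- second color.
  let y : V → α := fun v => if h v = true then y₀ v else y₀ (p v)
  have hyp : ∀ v ∈ W, p v ∈ W → y (p v) = y v ∧ x (p v) = x v ∧ y v ∈ P v ∧ y v ≠ x v := by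
    intro v hv hp
    have h1 := ht v hv
    have h2 := hxt v
    rw [F.t_eq_p v hv hp] at h1 h2
    have h3 := hPp v (by simp [hv, hp])
    by_cases h4 : h v = true
    · have h5 : ¬ h (p v) = true := fun h => h1.1 h h4
      simp only [y, if_pos h4, if_neg h5, F.p_p v hv hp]
      exact ⟨trivial, h2, hy₀P v, hy₀x v⟩
    · have h5 := h1.2 h4
      simp only [y, if_neg h4, if_pos h5]
      exact ⟨trivial, h2, h3 ▸ hy₀P (p v), h2 ▸ hy₀x (p v)⟩
  have hθ : ∀ v, ∃ θ ⊆ P v, θ.card = 2 ∧ x v ∉ θ ∧ (tail v →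
      (B v ∩ (θ ∪ {x (b v), y (b v)})).card ≤ 3 ∧ (C v ∩ (θ ∪ {x (g v), y (g v)})).card ≤ 3) := by
    intro v
    by_cases hv : tail v
    · obtain ⟨h1, h2⟩ := F.indep v hv.1 hv.2.1
      obtain ⟨θ, h3, h4, h5, h6, h7⟩ := exists_pair_of_leaf (hP v) (hB v hv.1) (hC v hv.1)
        (Finset.card_pair (hyp _ (F.b_mem v hv.1) h1).2.2.2.symm)
        (Finset.card_pair (hyp _ (F.g_mem v hv.1) h2).2.2.2.symm) (x v)
      exact ⟨θ, h3, h4, h5, fun _ => ⟨h6, h7⟩⟩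
    · obtain ⟨θ, h3, h4⟩ := Finset.exists_subset_card_eq (s := (P v).erase (x v)) (n := 2) (by
        have := Finset.pred_card_le_card_erase (s := P v) (a := x v)
        rw [hP] at this
        lia)
      exact ⟨θ, h3.trans (Finset.erase_subset _ _), h4,
        fun h => Finset.notMem_erase _ _ (h3 h), fun h => absurd h hv⟩
  choose θ hθP hθ2 hθx hθ using hθ
  -- The colors of the edges between two centers.
  let D : V → Finset α := fun z => P z \ ({x (τ z), x (τ (p z))} ∪ (θ (τ z) ∪ θ (τ (p z))))
  -- The two first colors cost one color together, the two tails at most four.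
  have hD : ∀ z ∉ W, 2 ≤ (D z).card := by
    intro z hz
    obtain ⟨h1, h2⟩ := hτ z hz
    have h3 := hx (τ z)
    simp only [T, g', if_pos h1, h2] at h3
    have h4 : (P z ∩ {x (τ z), x (τ (p z))}).card ≤ 1 := by
      rw [Finset.card_le_one]
      simp only [Finset.mem_inter, Finset.mem_insert, Finset.mem_singleton]
      rintro u ⟨hu, hu'⟩ v ⟨hv, hv'⟩
      grind
    have h5 := Finset.card_union_le (θ (τ z)) (θ (τ (p z)))
    rw [hθ2, hθ2] at h5
    have h6 := Finset.card_sdiff_add_card_inter (P z)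
      ({x (τ z), x (τ (p z))} ∪ (θ (τ z) ∪ θ (τ (p z))))
    rw [Finset.inter_union_distrib_left] at h6
    have h7 := Finset.card_union_le (P z ∩ {x (τ z), x (τ (p z))}) (P z ∩ (θ (τ z) ∪ θ (τ (p z))))
    have h8 := Finset.card_le_card
      (Finset.inter_subset_right : P z ∩ (θ (τ z) ∪ θ (τ (p z))) ⊆ _)
    rw [hP] at h6
    simp only [D]
    lia
  have hDp : ∀ z ∉ W, D (p z) = D z := by
    intro z hz
    obtain ⟨h1, h2, -⟩ := F.p_center z hz
    simp only [D, h2, hPp z (by simp [hz, h1])]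
    rw [Finset.pair_comm, Finset.union_comm (θ _)]
  have pick : ∀ S : Finset α, ∃ R ⊆ S, 2 ≤ S.card → R.card = 2 := fun S => by
    by_cases h : 2 ≤ S.card
    · obtain ⟨R, h1, h2⟩ := Finset.exists_subset_card_eq h
      exact ⟨R, h1, fun _ => h2⟩
    · exact ⟨∅, by simp, fun h' => absurd h' h⟩
  choose pk hpk hpk2 using pick
  let μ : V → Finset α := fun z => pk (D z)
  have hμ2 : ∀ z ∉ W, (μ z).card = 2 := fun z hz => hpk2 _ (hD z hz)
  have hμ : ∀ z ∉ W, ∀ u ∈ μ z, u ∈ P z ∧ u ≠ x (τ z) ∧ u ∉ θ (τ z) := by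
    intro z hz u hu
    have := hpk _ hu
    simp only [D, Finset.mem_sdiff, Finset.mem_union, Finset.mem_insert, Finset.mem_singleton]
      at this
    tauto
  -- The second colors of the other leaves.
  have hη : ∀ v, ∃ η ∈ P v, v ∈ W → p v ∉ W → η ≠ x v ∧ η ∉ θ (t v) ∧ η ∉ μ (p v) := by
    intro v
    by_cases hp : p v ∈ W
    · obtain ⟨u, hu⟩ := Finset.card_pos.1 (by rw [hP]; norm_num : 0 < (P v).card)
      exact ⟨u, hu, fun _ h => absurd hp h⟩
    · obtain ⟨u, hu⟩ : (P v \ ({x v} ∪ (θ (t v) ∪ μ (p v)))).Nonempty := by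
        rw [← Finset.card_pos]
        have h1 := Finset.le_card_sdiff ({x v} ∪ (θ (t v) ∪ μ (p v))) (P v)
        have h2 := Finset.card_union_le {x v} (θ (t v) ∪ μ (p v))
        have h3 := Finset.card_union_le (θ (t v)) (μ (p v))
        rw [hP] at h1
        rw [hθ2, hμ2 _ hp] at h3
        rw [Finset.card_singleton] at h2
        lia
      simp only [Finset.mem_sdiff, Finset.mem_union, Finset.mem_singleton] at hu
      exact ⟨u, hu.1, fun _ _ => by tauto⟩
  choose η hηP hη using hη
  let φ : V → Finset α := fun v =>
    if v ∈ W then if p v ∈ W then {x v, y v} else if h v = true then θ v else {x v, η v}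
    else μ v
  have φ_off : ∀ v ∉ W, φ v = μ v := fun v hv => by simp only [φ, if_neg hv]
  have φ_plain : ∀ v ∈ W, p v ∈ W → φ v = {x v, y v} := fun v hv hp => by
    simp only [φ, if_pos hv, if_pos hp]
  have φ_tail : ∀ v, tail v → φ v = θ v := fun v hv => by
    simp only [φ, if_pos hv.1, if_neg hv.2.1, if_pos hv.2.2]
  have φ_head : ∀ v ∈ W, p v ∉ W → ¬ h v = true → φ v = {x v, η v} := fun v hv hp hh => by
    simp only [φ, if_pos hv, if_neg hp, if_neg hh]
  have φ_nontail : ∀ v ∈ W, ¬ tail v → ∃ z, φ v = {x v, z} := by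
    intro v hv hnt
    by_cases hp : p v ∈ W
    · exact ⟨_, φ_plain v hv hp⟩
    · exact ⟨_, φ_head v hv hp fun hh => hnt ⟨hv, hp, hh⟩⟩
  have card_inter_union_singleton : ∀ (S : Finset α) (k : ℕ) (R : Finset α) (u : α), (S ∩ R).card ≤ k →
      (S ∩ (R ∪ {u})).card ≤ k + 1 := by
    intro S k R u hk
    rw [Finset.inter_union_distrib_left]
    have h1 := Finset.card_union_le (S ∩ R) (S ∩ {u})
    have h2 := Finset.card_le_card (Finset.inter_subset_right : S ∩ {u} ⊆ {u})
    rw [Finset.card_singleton] at h2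
    lia
  -- At the other end of the `b`-edge `h` is false, so there is no tail there: its first color is
  -- already counted and its second adds at most one.
  have main_B : ∀ v ∈ W, h v = true → (B v ∩ (φ v ∪ φ (b v))).card ≤ 3 := by
    intro v hv hhv
    by_cases hp : p v ∈ W
    · have h1 : ¬ tail (b v) := fun h => (hb v hv).1 h.2.2 hhv
      obtain ⟨z, hz⟩ := φ_nontail _ (F.b_mem v hv) h1
      have h2 := card_inter_union_singleton (B v) 2 {x v, x (b v), y₀ v} z (hy₀ v hv)
      rw [φ_plain v hv hp, hz]
      simp only [y, if_pos hhv]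
      refine (Finset.card_le_card ?_).trans h2
      intro u
      simp only [Finset.mem_inter, Finset.mem_union, Finset.mem_insert, Finset.mem_singleton]
      tauto
    · have h1 : tail v := ⟨hv, hp, hhv⟩
      rw [φ_tail v h1, φ_plain _ (F.b_mem v hv) (F.indep v hv hp).1]
      exact (hθ v h1).1
  have main_C : ∀ v ∈ W, tail v → (C v ∩ (φ v ∪ φ (g v))).card ≤ 3 := by
    intro v hv h1
    rw [φ_tail v h1, φ_plain _ (F.g_mem v hv) (F.indep v hv h1.2.1).2]
    exact (hθ v h1).2
  refine ⟨φ, fun v => ?_, fun v hvp => ?_, fun v hv hp => ?_, fun v hv => ⟨?_, ?_⟩⟩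
  · have pair : ∀ c d, c ∈ P v → d ∈ P v → c ≠ d → ({c, d} : Finset α) ⊆ P v ∧
        ({c, d} : Finset α).card = 2 := fun c d hc hd hcd =>
      ⟨Finset.insert_subset hc (Finset.singleton_subset_iff.2 hd), Finset.card_pair hcd⟩
    by_cases hv : v ∈ W
    · by_cases hp : p v ∈ W
      · rw [φ_plain v hv hp]
        obtain ⟨-, -, h1, h2⟩ := hyp v hv hp
        exact pair _ _ (hxP v fun h => h.2.1 hp) h1 h2.symm
      · by_cases hh : h v = true
        · rw [φ_tail v ⟨hv, hp, hh⟩]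
          exact ⟨hθP v, hθ2 v⟩
        · rw [φ_head v hv hp hh]
          exact pair _ _ (hxP v fun h => hh h.2.2) (hηP v) (hη v hv hp).1.symm
    · rw [φ_off v hv]
      exact ⟨fun u hu => (hμ v hv u hu).1, hμ2 v hv⟩
  · by_cases hv : v ∈ W
    · have hp := hvp.1 hv
      obtain ⟨h1, h2, -, -⟩ := hyp v hv hp
      rw [φ_plain v hv hp, φ_plain _ hp (by rwa [F.p_p v hv hp]), h1, h2]
    · have hp := (not_congr hvp).1 hv
      rw [φ_off v hv, φ_off _ hp]
      simp only [μ, hDp v hv]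
  · have tail_spec : ∀ v, tail v → v = τ (p v) := fun v hv =>
      tail_unique _ _ (hτ _ hv.2.1).1 hv (hτ _ hv.2.1).2.symm
    have tail_disj : ∀ v, tail v → Disjoint (φ v) (φ (t v)) ∧ Disjoint (φ v) (φ (p v)) ∧
        Disjoint (φ (t v)) (φ (p v)) := by
      intro v h1
      have hv := h1.1
      have hp := h1.2.1
      have hhv := h1.2.2
      obtain ⟨h2, -, h3, -⟩ := F.t_leaf v hv hp
      have h4 := hη (t v) h2 (by rwa [h3])
      rw [F.t_inv v, h3, hxt] at h4
      have h5 := hμ (p v) hp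
      rw [← tail_spec v h1] at h5
      rw [φ_tail v h1, φ_off _ hp, φ_head _ h2 (by rwa [h3]) (fun h => (ht v hv).1 h hhv), hxt]
      have h6 := hθx v
      simp only [Finset.disjoint_left, Finset.mem_insert, Finset.mem_singleton]
      exact ⟨by grind, fun u hu hu' => (h5 u hu').2.2 hu, by grind⟩
    obtain ⟨h2, -, h3, -⟩ := F.t_leaf v hv hp
    by_cases h1 : tail v
    · exact ⟨(tail_disj v h1).1, (tail_disj v h1).2.1⟩
    · have := tail_disj (t v) ((htail_t v hv hp).2 h1)
      rw [F.t_inv v, h3] at this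
      exact ⟨this.1.symm, this.2.2⟩
  · by_cases hh : h v = true
    · exact main_B v hv hh
    · have := main_B (b v) (F.b_mem v hv) ((hb v hv).2 hh)
      rwa [F.b_inv v, hBb v hv, Finset.union_comm] at this
  · by_cases h1 : tail v
    · exact main_C v hv h1
    by_cases h2 : tail (g v)
    · have := main_C (g v) (F.g_mem v hv) h2
      rwa [F.g_inv v, hCg v hv, Finset.union_comm] at this
    obtain ⟨z, hz⟩ := φ_nontail v hv h1
    obtain ⟨z', hz'⟩ := φ_nontail _ (F.g_mem v hv) h2
    -- Without a tail, the first colors cost at most one and the two second colors at most one each.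
    have h3 : (C v ∩ {x v, x (g v)}).card ≤ 1 := by
      have := hx₂ v hv h1 h2
      rw [Finset.card_le_one]
      simp only [Finset.mem_inter, Finset.mem_insert, Finset.mem_singleton]
      rintro u ⟨hu, hu'⟩ v ⟨hv, hv'⟩
      grind
    have h4 := card_inter_union_singleton _ _ _ z' (card_inter_union_singleton _ _ _ z h3)
    refine (Finset.card_le_card ?_).trans h4
    rw [hz, hz']
    intro u
    simp only [Finset.mem_inter, Finset.mem_union, Finset.mem_insert, Finset.mem_singleton]
    tauto

end Frame

/-! ### Assembling the edge coloring. -/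

theorem isEdgeChoosable_of_symmetric {V : Type u} {G : SimpleGraph V} {r s : ℕ}
    (H : ∀ (α : Type w) (ℓ : V → V → Finset α), (∀ v w, ℓ v w = ℓ w v) →
      (∀ v w, G.Adj v w → (ℓ v w).card = r) →
      ∃ c : V → V → Finset α, (∀ v w, G.Adj v w → c v w = c w v ∧ c v w ⊆ ℓ v w ∧
        (c v w).card = s) ∧ ∀ v w w', G.Adj v w → G.Adj v w' → w ≠ w' →
        Disjoint (c v w) (c v w')) :
    IsEdgeChoosable.{u, w} G r s := by
  classical
  intro α L hL
  obtain ⟨c, hc, hd⟩ := H α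
    (fun v w => if h : G.Adj v w then L ⟨s(v, w), h⟩ else ∅)
    (fun v w => by
      by_cases h : G.Adj v w
      · simp only [dif_pos h, dif_pos h.symm, Sym2.eq_swap (a := v)]
      · have h' : ¬ G.Adj w v := fun h' => h h'.symm
        simp only [dif_neg h, dif_neg h'])
    (fun v w h => by simp only [dif_pos h]; exact hL _)
  have key : ∀ e : G.edgeSet, ∃ S : Finset α, ∀ v w, (e : Sym2 V) = s(v, w) → S = c v w := by
    rintro ⟨e, he⟩
    induction e with
    | h v w =>
      refine ⟨c v w, fun v' w' h => ?_⟩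
      rcases Sym2.eq_iff.1 h with ⟨rfl, rfl⟩ | ⟨rfl, rfl⟩
      · rfl
      · exact (hc _ _ he).1
  choose φ hφ using key
  refine ⟨φ, fun e => ?_, fun e f hef => ?_⟩
  · obtain ⟨e, he⟩ := e
    induction e with
    | h v w =>
      rw [hφ ⟨s(v, w), he⟩ v w rfl]
      have h : G.Adj v w := he
      have := (hc v w h).2
      simpa only [dif_pos h] using this
  · rintro ⟨v, hve, hvf⟩
    obtain ⟨e, he⟩ := e
    obtain ⟨f, hf⟩ := f
    obtain ⟨w, rfl⟩ := hve
    obtain ⟨w', rfl⟩ := hvf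
    rw [hφ ⟨s(v, w), he⟩ v w rfl, hφ ⟨s(v, w'), hf⟩ v w' rfl]
    refine hd v w w' he hf ?_
    rintro rfl
    exact hef rfl

namespace Frame

variable {V : Type u} {G : SimpleGraph V} {W : Set V} {b g p t : V → V}

theorem adj_p (F : Frame G W b g p t) (v : V) : G.Adj v (p v) := by
  by_cases hv : v ∈ W
  · exact (F.adj_iff v hv _).2 (Or.inr (Or.inr rfl))
  · exact (F.p_center v hv).2.2

theorem p_p_of_iff (F : Frame G W b g p t) {v : V} (h : v ∈ W ↔ p v ∈ W) : p (p v) = v := by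
  by_cases hv : v ∈ W
  · exact F.p_p v hv (h.1 hv)
  · exact (F.p_center v hv).2.1

theorem adj_center (F : Frame G W b g p t) {v w : V} (hv : v ∉ W) (h : G.Adj v w) :
    w = p v ∨ w ∈ W ∧ p w = v := by
  by_cases hw : w ∈ W
  · rcases (F.adj_iff w hw v).1 h.symm with h1 | h1 | h1
    · exact absurd (h1 ▸ F.b_mem w hw) hv
    · exact absurd (h1 ▸ F.g_mem w hw) hv
    · exact Or.inr ⟨hw, h1.symm⟩
  · exact Or.inl (F.center_adj v hv w hw h)

theorem isEdgeChoosable (F : Frame G W b g p t) : IsEdgeChoosable.{u, w} G 7 2 := by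
  classical
  refine isEdgeChoosable_of_symmetric fun α ℓ hℓ hcard => ?_
  have adj_b : ∀ v ∈ W, G.Adj v (b v) := fun v hv => (F.adj_iff v hv _).2 (Or.inl rfl)
  have adj_g : ∀ v ∈ W, G.Adj v (g v) := fun v hv => (F.adj_iff v hv _).2 (Or.inr (Or.inl rfl))
  obtain ⟨φ, hφ, hφp, hφt, hφc⟩ := F.exists_pendant_coloring (fun v => ℓ v (p v))
    (fun v => ℓ v (b v)) (fun v => ℓ v (g v)) (fun v => hcard _ _ (F.adj_p v))
    (fun v hv => hcard _ _ (adj_b v hv)) (fun v hv => hcard _ _ (adj_g v hv))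
    (fun v hv => by rw [F.p_p_of_iff hv, hℓ]) (fun v _ => by rw [F.b_inv v, hℓ])
    (fun v _ => by rw [F.g_inv v, hℓ])
  have left : ∀ S R : Finset α, S.card = 7 → (S ∩ R).card ≤ 3 → 4 ≤ (S \ R).card := by
    intro S R h1 h2
    have := Finset.card_sdiff_add_card_inter S R
    lia
  obtain ⟨β, γ, hβ, hγ, hβγ⟩ := exists_cycle_coloring F.b_inv F.g_inv
    -- Centers are fixed by `b` and `g`; their lists are dummies that only need 4 colors.
    (fun v => if v ∈ W then ℓ v (b v) \ (φ v ∪ φ (b v)) else ℓ v (p v))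
    (fun v => if v ∈ W then ℓ v (g v) \ (φ v ∪ φ (g v)) else ℓ v (p v))
    (fun v => by
      by_cases hv : v ∈ W
      · simp only [if_pos hv]
        exact left _ _ (hcard _ _ (adj_b v hv)) (hφc v hv).1
      · simp only [if_neg hv, hcard _ _ (F.adj_p v)]; norm_num)
    (fun v => by
      by_cases hv : v ∈ W
      · simp only [if_pos hv]
        exact left _ _ (hcard _ _ (adj_g v hv)) (hφc v hv).2
      · simp only [if_neg hv, hcard _ _ (F.adj_p v)]; norm_num)
    (fun v => by
      by_cases hv : v ∈ W
      · simp only [if_pos hv, if_pos (F.b_mem v hv), F.b_inv v, hℓ (b v), Finset.union_comm]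
      · simp only [F.b_off v hv])
    (fun v => by
      by_cases hv : v ∈ W
      · simp only [if_pos hv, if_pos (F.g_mem v hv), F.g_inv v, hℓ (g v), Finset.union_comm]
      · simp only [F.g_off v hv])
  -- The color of an edge from a center to a leaf is stored at the leaf, which is why the last case
  -- reads `φ w`.
  let c : V → V → Finset α := fun v w =>
    if v ∈ W ∧ w = b v then β v else if v ∈ W ∧ w = g v then γ v else if w = p v then φ v else φ w
  have c_b : ∀ v ∈ W, c v (b v) = β v := fun v hv => by simp [c, hv]
  have c_g : ∀ v ∈ W, c v (g v) = γ v := fun v hv => by simp [c, hv, (F.b_ne_g v hv).symm]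
  have c_p : ∀ v, c v (p v) = φ v := fun v => by
    by_cases hv : v ∈ W
    · simp [c, (F.b_ne_p v hv).symm, (F.g_ne_p v hv).symm]
    · simp [c, hv]
  have c_leaf : ∀ w ∈ W, p w ∉ W → c (p w) w = φ w := fun w hw hp => by
    have : w ≠ p (p w) := fun h => (F.p_center _ hp).1 (h ▸ hw)
    simp [c, hp, this]
  have hβW : ∀ v ∈ W, β v ⊆ ℓ v (b v) \ (φ v ∪ φ (b v)) := fun v hv => by
    have := (hβ v).1
    simpa only [if_pos hv] using this
  have hγW : ∀ v ∈ W, γ v ⊆ ℓ v (g v) \ (φ v ∪ φ (g v)) := fun v hv => by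
    have := (hγ v).1
    simpa only [if_pos hv] using this
  refine ⟨c, fun v w h => ?_, fun v w w' h h' hne => ?_⟩
  · by_cases hv : v ∈ W
    · rcases (F.adj_iff v hv w).1 h with rfl | rfl | rfl
      · have := c_b _ (F.b_mem v hv)
        rw [F.b_inv v, (hβ v).2.2] at this
        rw [c_b v hv, this]
        exact ⟨rfl, (hβW v hv).trans Finset.sdiff_subset, (hβ v).2.1⟩
      · have := c_g _ (F.g_mem v hv)
        rw [F.g_inv v, (hγ v).2.2] at this
        rw [c_g v hv, this]
        exact ⟨rfl, (hγW v hv).trans Finset.sdiff_subset, (hγ v).2.1⟩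
      · rw [c_p]
        refine ⟨?_, hφ v⟩
        by_cases hp : p v ∈ W
        · have := c_p (p v)
          rw [F.p_p v hv hp, hφp v (by simp [hv, hp])] at this
          exact this.symm
        · exact (c_leaf v hv hp).symm
    · rcases F.adj_center hv h with rfl | ⟨hw, rfl⟩
      · obtain ⟨h1, h2, -⟩ := F.p_center v hv
        have := c_p (p v)
        rw [h2, hφp v (by simp [hv, h1])] at this
        rw [c_p, this]
        exact ⟨rfl, hφ v⟩
      · rw [c_leaf w hw hv, c_p, hℓ]
        exact ⟨rfl, hφ w⟩
  -- By symmetry `w` precedes `w'` in the order `b v`, `g v`, `p v`, or `v` is a center and `w'` one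
  -- of its leaves.
  · wlog hle : (w = b v ∨ w = g v ∧ w' ≠ b v ∨ w = p v ∧ w' ≠ b v ∧ w' ≠ g v) ∨ v ∉ W ∧ w' ≠ p v
      generalizing w w'
    · refine (this w' w h' h hne.symm ?_).symm
      by_cases hv : v ∈ W
      · have h1 := (F.adj_iff v hv w).1 h
        have h2 := (F.adj_iff v hv w').1 h'
        have h3 := F.b_ne_g v hv
        have h4 := F.b_ne_p v hv
        have h5 := F.g_ne_p v hv
        grind
      · grind
    by_cases hv : v ∈ W
    · have h2 := (F.adj_iff v hv w').1 h'
      have disj : ∀ {S R Q N : Finset α}, S ⊆ R \ (Q ∪ N) → Disjoint S Q := by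
        intro S R Q N hS
        rw [Finset.disjoint_left]
        intro u hu
        have := hS hu
        simp only [Finset.mem_sdiff, Finset.mem_union] at this
        tauto
      rcases hle with (rfl | ⟨rfl, h3⟩ | ⟨rfl, h3, h4⟩) | hle
      · rw [c_b v hv]
        rcases h2 with rfl | rfl | rfl
        · exact absurd rfl hne
        · rw [c_g v hv]; exact hβγ v
        · rw [c_p]; exact disj (hβW v hv)
      · rw [c_g v hv]
        rcases h2 with rfl | rfl | rfl
        · exact absurd rfl h3
        · exact absurd rfl hne
        · rw [c_p]; exact disj (hγW v hv)
      · rcases h2 with rfl | rfl | rfl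
        exacts [absurd rfl h3, absurd rfl h4, absurd rfl hne]
      · exact absurd hv hle.1
    · rcases F.adj_center hv h with rfl | ⟨hw, rfl⟩
      · rcases F.adj_center hv h' with rfl | ⟨hw', rfl⟩
        · exact absurd rfl hne
        · rw [c_p, c_leaf w' hw' hv]
          exact (hφt w' hw' hv).2.symm
      · rcases F.adj_center hv h' with rfl | ⟨hw', hp'⟩
        · rw [c_p, c_leaf w hw hv]
          exact (hφt w hw hv).2
        · rcases (F.t_leaf w hw hv).2.2.2 w' hw' hp' with rfl | rfl
          · exact absurd rfl hne
          · have := c_leaf _ hw' (by rwa [hp'])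
            rw [hp'] at this
            rw [c_leaf w hw hv, this]
            exact (hφt w hw hv).1

end Frame

/-! ### Even cycles and double-stars. -/

theorem cycleGraph_adj_iff_val {n : ℕ} (hn : 2 ≤ n) (u v : Fin n) :
    (SimpleGraph.cycleGraph n).Adj u v ↔ (v.val = u.val + 1 ∨ v.val = 0 ∧ u.val + 1 = n) ∨
      (u.val = v.val + 1 ∨ u.val = 0 ∧ v.val + 1 = n) := by
  have key : ∀ u v : Fin n, (u - v).val = 1 ↔ (u.val = v.val + 1 ∨ u.val = 0 ∧ v.val + 1 = n) := by
    intro u v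
    have hu := u.2
    have hv := v.2
    rcases le_or_gt v u with h | h
    · rw [Fin.sub_val_of_le h]
      rw [Fin.le_def] at h
      lia
    · rw [Fin.coe_sub_iff_lt.2 h]
      rw [Fin.lt_def] at h
      lia
  rw [SimpleGraph.cycleGraph_adj', key, key, or_comm]

theorem exists_alternating_neighbors_cycleGraph {n : ℕ} (hn : 3 ≤ n) (he : Even n) :
    ∃ β γ : Fin n → Fin n, Involutive β ∧ Involutive γ ∧ (∀ i, β i ≠ γ i) ∧
      ∀ i j, (SimpleGraph.cycleGraph n).Adj i j ↔ j = β i ∨ j = γ i := by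
  obtain ⟨m, rfl⟩ := he
  -- `β` pairs `2k` with `2k + 1`, and `γ` pairs `2k + 1` with `2k + 2` modulo the length; parity
  -- makes both involutions.
  let β : Fin (m + m) → Fin (m + m) := fun i =>
    ⟨if i.val % 2 = 0 then i.val + 1 else i.val - 1, by have := i.2; split_ifs <;> lia⟩
  let γ : Fin (m + m) → Fin (m + m) := fun i =>
    ⟨if i.val % 2 = 0 then (if i.val = 0 then m + m - 1 else i.val - 1)
      else (if i.val + 1 = m + m then 0 else i.val + 1), by have := i.2; split_ifs <;> lia⟩
  have hβ : ∀ i, (β i).val = if i.val % 2 = 0 then i.val + 1 else i.val - 1 := fun _ => rfl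
  have hγ : ∀ i, (γ i).val = if i.val % 2 = 0 then (if i.val = 0 then m + m - 1 else i.val - 1)
      else (if i.val + 1 = m + m then 0 else i.val + 1) := fun _ => rfl
  refine ⟨β, γ, fun i => ?_, fun i => ?_, fun i => ?_, fun i j => ?_⟩
  · have := i.2
    rw [Fin.ext_iff, hβ, hβ]
    split_ifs <;> lia
  · have := i.2
    rw [Fin.ext_iff, hγ, hγ]
    split_ifs <;> lia
  · have := i.2
    rw [Ne, Fin.ext_iff, hβ, hγ]
    split_ifs <;> lia
  · have := i.2
    have := j.2
    rw [cycleGraph_adj_iff_val (by lia), Fin.ext_iff, Fin.ext_iff, hβ, hγ]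
    split_ifs <;> lia

theorem exists_alternating_neighbors {U : Type u} (H : SimpleGraph U)
    (hH : ∀ c : H.ConnectedComponent, IsEvenCycle c.toSimpleGraph) :
    ∃ β γ : U → U, Involutive β ∧ Involutive γ ∧ (∀ v, β v ≠ γ v) ∧
      ∀ v w, H.Adj v w ↔ w = β v ∨ w = γ v := by
  classical
  have key : ∀ c : H.ConnectedComponent, ∃ β γ : U → U, ∀ v ∈ c.supp, β v ∈ c.supp ∧
      γ v ∈ c.supp ∧ β (β v) = v ∧ γ (γ v) = v ∧ β v ≠ γ v ∧
      ∀ w, H.Adj v w ↔ w = β v ∨ w = γ v := by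
    intro c
    obtain ⟨n, hn, he, ⟨f⟩⟩ := hH c
    obtain ⟨β, γ, hβ, hγ, hne, hadj⟩ := exists_alternating_neighbors_cycleGraph hn he
    refine ⟨fun v => if hv : v ∈ c.supp then (f.symm (β (f ⟨v, hv⟩))).1 else v,
      fun v => if hv : v ∈ c.supp then (f.symm (γ (f ⟨v, hv⟩))).1 else v, fun v hv => ?_⟩
    have h1 : (f.symm (β (f ⟨v, hv⟩))).1 ∈ c.supp := (f.symm (β (f ⟨v, hv⟩))).2
    have h2 : (f.symm (γ (f ⟨v, hv⟩))).1 ∈ c.supp := (f.symm (γ (f ⟨v, hv⟩))).2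
    simp only [dif_pos hv, dif_pos h1, dif_pos h2]
    refine ⟨h1, h2, ?_, ?_, ?_, fun w => ?_⟩
    · simp [hβ (f ⟨v, hv⟩)]
    · simp [hγ (f ⟨v, hv⟩)]
    · intro h
      exact hne _ (f.symm.injective (Subtype.ext h))
    · constructor
      · intro h
        have hw : w ∈ c.supp := c.mem_supp_of_adj_mem_supp hv h
        have h3 : c.toSimpleGraph.Adj ⟨v, hv⟩ ⟨w, hw⟩ := h
        rw [← f.map_adj_iff, hadj] at h3
        rcases h3 with h3 | h3
        · left; rw [← h3]; simp
        · right; rw [← h3]; simp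
      · have h4 : ∀ k, (SimpleGraph.cycleGraph n).Adj (f ⟨v, hv⟩) k → H.Adj v (f.symm k).1 := by
          intro k hk
          have : c.toSimpleGraph.Adj ⟨v, hv⟩ (f.symm k) := by
            rw [← f.map_adj_iff]; simpa using hk
          exact this
        rintro (rfl | rfl)
        · exact h4 _ ((hadj _ _).2 (Or.inl rfl))
        · exact h4 _ ((hadj _ _).2 (Or.inr rfl))
  choose β γ h using key
  have hβ : ∀ v, H.connectedComponentMk (β (H.connectedComponentMk v) v) = H.connectedComponentMk v :=
    fun v => (h _ v rfl).1
  have hγ : ∀ v, H.connectedComponentMk (γ (H.connectedComponentMk v) v) = H.connectedComponentMk v :=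
    fun v => (h _ v rfl).2.1
  refine ⟨fun v => β (H.connectedComponentMk v) v, fun v => γ (H.connectedComponentMk v) v,
    fun v => ?_, fun v => ?_, fun v => (h _ v rfl).2.2.2.2.1, fun v => (h _ v rfl).2.2.2.2.2⟩
  · simp only [hβ]; exact (h _ v rfl).2.2.1
  · simp only [hγ]; exact (h _ v rfl).2.2.2.1

theorem IsDoubleStar.ncard_neighborSet {U : Type u} {T : SimpleGraph U} (hT : IsDoubleStar T) (v : U) :
    (T.neighborSet v).ncard = 1 ∨
    ((T.neighborSet v).ncard = 3 ∧ ∃ y a c, a ≠ c ∧ (T.neighborSet y).ncard = 3 ∧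
      (T.neighborSet a).ncard = 1 ∧ (T.neighborSet c).ncard = 1 ∧
      ∀ w, T.Adj v w ↔ w = y ∨ w = a ∨ w = c) := by
  classical
  obtain ⟨htree, hcard, x, y, hxy, hx, hy⟩ := hT
  have hfin : Finite U := Nat.finite_of_card_ne_zero (by rw [hcard]; norm_num)
  have := Fintype.ofFinite U
  rw [Nat.card_eq_fintype_card] at hcard
  have hdeg : ∀ u, (T.neighborSet u).ncard = T.degree u := fun u => by
    rw [Set.ncard_eq_toFinset_card', ← SimpleGraph.card_neighborFinset_eq_degree]; rfl
  have hsum := T.sum_degrees_eq_twice_card_edges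
  have hedge := htree.card_edgeFinset
  have hne := T.ne_of_adj hxy
  have hnt : Nontrivial U := ⟨x, y, hne⟩
  simp only [hdeg] at hx hy ⊢
  have hpos : ∀ u, 1 ≤ T.degree u := fun u => htree.connected.preconnected.degree_pos_of_nontrivial u
  have hrest : ∀ u, u ≠ x → u ≠ y → T.degree u = 1 := by
    -- The degrees sum to 2 · 5 = 10 and the two centers account for 6; the four other degrees are
    -- positive with sum 4.
    have h1 : ∑ u ∈ (Finset.univ.erase x).erase y, T.degree u = 4 := by
      have h2 := Finset.add_sum_erase Finset.univ (fun u => T.degree u) (Finset.mem_univ x)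
      have h3 := Finset.add_sum_erase (Finset.univ.erase x) (fun u => T.degree u) (a := y)
        (by simp [hne.symm])
      lia
    have h2 : ((Finset.univ.erase x).erase y).card = 4 := by
      rw [Finset.card_erase_of_mem (by simp [hne.symm]), Finset.card_erase_of_mem (by simp),
        Finset.card_univ, hcard]
    have h3 := (Finset.sum_eq_sum_iff_of_le (s := (Finset.univ.erase x).erase y)
      (f := fun _ => 1) (g := fun u => T.degree u) (fun u _ => hpos u)).1 (by rw [h1]; simp [h2])
    intro u hux huy
    exact (h3 u (by simp [hux, huy])).symm
  have hcenter : ∀ x y, T.Adj x y → T.degree x = 3 → T.degree y = 3 →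
      (∀ u, u ≠ x → u ≠ y → T.degree u = 1) → T.degree x = 3 ∧ ∃ y a c, a ≠ c ∧ T.degree y = 3 ∧
      T.degree a = 1 ∧ T.degree c = 1 ∧ ∀ w, T.Adj x w ↔ w = y ∨ w = a ∨ w = c := by
    intro x y hxy hx hy hrest
    refine ⟨hx, ?_⟩
    have h1 : ((T.neighborFinset x).erase y).card = 2 := by
      rw [Finset.card_erase_of_mem (by simpa using hxy), SimpleGraph.card_neighborFinset_eq_degree,
        hx]
    obtain ⟨a, c, hac, h2⟩ := Finset.card_eq_two.1 h1
    have h3 : ∀ w, (w ≠ y ∧ T.Adj x w) ↔ w = a ∨ w = c := fun w => by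
      have := Finset.ext_iff.1 h2 w
      simpa using this
    have ha := (h3 a).2 (Or.inl rfl)
    have hc := (h3 c).2 (Or.inr rfl)
    refine ⟨y, a, c, hac, hy, hrest a ha.2.ne' ha.1, hrest c hc.2.ne' hc.1, fun w => ?_⟩
    rw [← h3]
    by_cases hw : w = y
    · simp [hw, hxy]
    · simp [hw]
  by_cases hvx : v = x
  · rw [hvx]; exact Or.inr (hcenter x y hxy hx hy hrest)
  by_cases hvy : v = y
  · rw [hvy]; exact Or.inr (hcenter y x hxy.symm hy hx fun u h1 h2 => hrest u h2 h1)
  exact Or.inl (hrest v hvx hvy)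

theorem doubleStars_structure {V : Type u} {G : SimpleGraph V} {S : G.Subgraph}
    (hS : ∀ c : S.coe.ConnectedComponent, IsDoubleStar c.toSimpleGraph) {v : V} (hv : v ∈ S.verts) :
    (S.neighborSet v).ncard = 1 ∨
    ((S.neighborSet v).ncard = 3 ∧ ∃ y a c, a ≠ c ∧ (S.neighborSet y).ncard = 3 ∧
      (S.neighborSet a).ncard = 1 ∧ (S.neighborSet c).ncard = 1 ∧
      ∀ w, S.Adj v w ↔ w = y ∨ w = a ∨ w = c) := by
  let C := S.coe.connectedComponentMk ⟨v, hv⟩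
  have hadj : ∀ (u : C) (w : V), S.Adj u.1.1 w ↔ ∃ u' : C, C.toSimpleGraph.Adj u u' ∧ u'.1.1 = w := by
    intro u w
    constructor
    · intro h
      have hw : S.coe.Adj u.1 ⟨w, S.edge_vert h.symm⟩ := h
      exact ⟨⟨_, C.mem_supp_of_adj_mem_supp u.2 hw⟩, hw, rfl⟩
    · rintro ⟨u', h, rfl⟩
      exact h
  have hinj : Injective fun u : C => u.1.1 :=
    Subtype.val_injective.comp Subtype.val_injective
  have hcard : ∀ u : C, (S.neighborSet u.1.1).ncard = (C.toSimpleGraph.neighborSet u).ncard := by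
    intro u
    rw [← Set.ncard_image_of_injective _ hinj]
    congr 1
    ext w
    simp only [SimpleGraph.Subgraph.mem_neighborSet, hadj, Set.mem_image,
      SimpleGraph.mem_neighborSet]
  rcases (hS C).ncard_neighborSet ⟨⟨v, hv⟩, rfl⟩ with h1 | ⟨h1, y, a, c, hac, hy, ha, hc, h⟩
  · exact Or.inl ((hcard _).trans h1)
  · refine Or.inr ⟨(hcard _).trans h1, y.1.1, a.1.1, c.1.1, fun h => hac (hinj h),
      (hcard _).trans hy, (hcard _).trans ha, (hcard _).trans hc, fun w => ?_⟩
    rw [hadj ⟨⟨v, hv⟩, rfl⟩ w]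
    simp only [h]
    constructor
    · rintro ⟨u', rfl | rfl | rfl, rfl⟩ <;> simp
    · rintro (rfl | rfl | rfl)
      exacts [⟨y, by simp, rfl⟩, ⟨a, by simp, rfl⟩, ⟨c, by simp, rfl⟩]

/-! ### From a decomposition to a frame. -/

/-- A vertex off the cycles has at most one matching edge, hence at least two edges in `G₃`, so it
is a center and all its edges are in `G₃`. Conversely no center meets a cycle edge. So `W` is the
set of non-centers, and it contains every leaf. -/
theorem IsMEDDecomposition.exists_frame {V : Type u} [Fintype V] {G : SimpleGraph V}
    [DecidableRel G.Adj] (hreg : G.IsRegularOfDegree 3) {G₁ G₂ G₃ : G.Subgraph}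
    (hM : IsMEDDecomposition G G₁ G₂ G₃) :
    ∃ (W : Set V) (b g p t : V → V), Frame G W b g p t := by
  classical
  obtain ⟨β, γ, hβ, hγ, hne, hadj⟩ := exists_alternating_neighbors G₂.coe hM.evenCycles
  let W : Set V := G₂.verts
  let b : V → V := fun v => if hv : v ∈ W then (β ⟨v, hv⟩).1 else v
  let g : V → V := fun v => if hv : v ∈ W then (γ ⟨v, hv⟩).1 else v
  have b_eq : ∀ v (hv : v ∈ W), b v = (β ⟨v, hv⟩).1 := fun v hv => by simp only [b, dif_pos hv]
  have g_eq : ∀ v (hv : v ∈ W), g v = (γ ⟨v, hv⟩).1 := fun v hv => by simp only [g, dif_pos hv]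
  have b_off : ∀ v ∉ W, b v = v := fun v hv => by simp only [b, dif_neg hv]
  have g_off : ∀ v ∉ W, g v = v := fun v hv => by simp only [g, dif_neg hv]
  have b_mem : ∀ v ∈ W, b v ∈ W := fun v hv => by rw [b_eq v hv]; exact (β ⟨v, hv⟩).2
  have g_mem : ∀ v ∈ W, g v ∈ W := fun v hv => by rw [g_eq v hv]; exact (γ ⟨v, hv⟩).2
  have b_inv : Involutive b := fun v => by
    by_cases hv : v ∈ W
    · rw [b_eq _ (b_mem v hv)]
      simp only [b_eq v hv, Subtype.coe_eta, hβ ⟨v, hv⟩]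
    · rw [b_off v hv, b_off v hv]
  have g_inv : Involutive g := fun v => by
    by_cases hv : v ∈ W
    · rw [g_eq _ (g_mem v hv)]
      simp only [g_eq v hv, Subtype.coe_eta, hγ ⟨v, hv⟩]
    · rw [g_off v hv, g_off v hv]
  have adj₂b : ∀ v ∈ W, G₂.Adj v (b v) := fun v hv => by
    rw [b_eq v hv]; exact (hadj ⟨v, hv⟩ _).2 (Or.inl rfl)
  have adj₂g : ∀ v ∈ W, G₂.Adj v (g v) := fun v hv => by
    rw [g_eq v hv]; exact (hadj ⟨v, hv⟩ _).2 (Or.inr rfl)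
  have b_ne_g : ∀ v ∈ W, b v ≠ g v := fun v hv => by
    rw [b_eq v hv, g_eq v hv]; exact fun h => hne _ (Subtype.ext h)
  have cover : ∀ v w, G.Adj v w → G₁.Adj v w ∨ G₂.Adj v w ∨ G₃.Adj v w := by
    intro v w h
    have h1 : s(v, w) ∈ G₁.edgeSet ∪ G₂.edgeSet ∪ G₃.edgeSet := by rw [hM.edgeSet_union]; exact h
    rcases h1 with (h1 | h1) | h1
    exacts [Or.inl h1, Or.inr (Or.inl h1), Or.inr (Or.inr h1)]
  have not₂₃ : ∀ v w, G₂.Adj v w → ¬ G₃.Adj v w := fun v w h h' =>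
    (Set.disjoint_left.1 hM.disjoint₂₃ : ∀ ⦃e⦄, e ∈ _ → e ∉ _) (show s(v, w) ∈ _ from h) h'
  have degree_three : ∀ v, (G.neighborSet v).ncard = 3 := fun v => by
    rw [Set.ncard_eq_toFinset_card']
    exact hreg v
  let d : V → ℕ := fun v => (G₃.neighborSet v).ncard
  -- A vertex of degree three in `G₃` has all its edges there.
  have adj₃ : ∀ v, d v = 3 → ∀ w, G.Adj v w ↔ G₃.Adj v w := by
    intro v hv w
    have h1 : G₃.neighborSet v = G.neighborSet v :=
      Set.eq_of_subset_of_ncard_le (G₃.neighborSet_subset v) (by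
        rw [degree_three]; exact hv.ge) (Set.toFinite _)
    exact (Set.ext_iff.1 h1 w).symm
  have d_center : ∀ v, d v = 3 → v ∉ W := fun v hv hvW =>
    not₂₃ _ _ (adj₂b v hvW) ((adj₃ v hv _).1 (G₂.adj_sub (adj₂b v hvW)))
  have star : ∀ v ∉ W, d v = 3 ∧ ∃ y a c, a ≠ c ∧ d y = 3 ∧ d a = 1 ∧ d c = 1 ∧
      ∀ w, G₃.Adj v w ↔ w = y ∨ w = a ∨ w = c := by
    intro v hv
    have h₂ : ∀ w, G.Adj v w → ¬ G₁.Adj v w → G₃.Adj v w := fun w h h1 => by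
      rcases cover v w h with h2 | h2 | h2
      exacts [absurd h2 h1, absurd (G₂.edge_vert h2) hv, h2]
    obtain ⟨w₁, w₂, w₃, h12, h13, h23, hN⟩ := Set.ncard_eq_three.1 (degree_three v)
    have hNadj : ∀ w, G.Adj v w ↔ w = w₁ ∨ w = w₂ ∨ w = w₃ := fun w => by
      have := Set.ext_iff.1 hN w
      simpa using this
    have huniq : ∀ w w', G₁.Adj v w → G₁.Adj v w' → w = w' := fun w w' h h' =>
      (hM.matching (G₁.edge_vert h)).unique h h'
    obtain ⟨w, w', hww, h, h'⟩ : ∃ w w', w ≠ w' ∧ G₃.Adj v w ∧ G₃.Adj v w' := by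
      have a1 := h₂ w₁ ((hNadj _).2 (by simp))
      have a2 := h₂ w₂ ((hNadj _).2 (by simp))
      have a3 := h₂ w₃ ((hNadj _).2 (by simp))
      by_cases h1 : G₁.Adj v w₁
      · exact ⟨w₂, w₃, h23, a2 fun h => h12 (huniq _ _ h1 h), a3 fun h => h13 (huniq _ _ h1 h)⟩
      · by_cases h2 : G₁.Adj v w₂
        · exact ⟨w₁, w₃, h13, a1 h1, a3 fun h => h23 (huniq _ _ h2 h)⟩
        · exact ⟨w₁, w₂, h12, a1 h1, a2 h2⟩
    rcases doubleStars_structure hM.doubleStars.1 (G₃.edge_vert h) with h1 | h1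
    · obtain ⟨z, hz⟩ := Set.ncard_eq_one.1 h1
      have e1 : w ∈ G₃.neighborSet v := h
      have e2 : w' ∈ G₃.neighborSet v := h'
      rw [hz] at e1 e2
      exact absurd (Eq.trans e1 (Eq.symm e2)) hww
    · exact h1
  have d_one : ∀ v, d v = 1 → v ∈ W := fun v hv => by
    by_contra h
    have := (star v h).1
    lia
  have exists_p : ∀ v, ∃ q, G.Adj v q ∧ (v ∈ W → b v ≠ q ∧ g v ≠ q ∧
      ∀ w, G.Adj v w ↔ w = b v ∨ w = g v ∨ w = q) ∧
      (v ∉ W → q ∉ W ∧ (∀ w ∉ W, G.Adj v w → w = q) ∧ ∃ a ∈ W, ∃ c ∈ W, a ≠ c ∧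
        ∀ w, G.Adj v w ↔ w = q ∨ w = a ∨ w = c) := by
    intro v
    by_cases hv : v ∈ W
    · have h1 : (((G.neighborFinset v).erase (b v)).erase (g v)).card = 1 := by
        rw [Finset.card_erase_of_mem, Finset.card_erase_of_mem,
          SimpleGraph.card_neighborFinset_eq_degree, hreg v]
        · simpa using G₂.adj_sub (adj₂b v hv)
        · simpa using ⟨(b_ne_g v hv).symm, G₂.adj_sub (adj₂g v hv)⟩
      obtain ⟨q, hq⟩ := Finset.card_eq_one.1 h1
      have h2 : ∀ w, (w ≠ g v ∧ w ≠ b v ∧ G.Adj v w) ↔ w = q := fun w => by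
        have := Finset.ext_iff.1 hq w
        simpa using this
      obtain ⟨h3, h4, h5⟩ := (h2 q).2 rfl
      refine ⟨q, h5, fun _ => ⟨h4.symm, h3.symm, fun w => ?_⟩, fun h => absurd hv h⟩
      have hb := G₂.adj_sub (adj₂b v hv)
      have hg := G₂.adj_sub (adj₂g v hv)
      rw [← h2]
      by_cases hwb : w = b v
      · simp [hwb, hb]
      · by_cases hwg : w = g v
        · simp [hwg, hg]
        · simp [hwb, hwg]
    · obtain ⟨h1, y, a, c, hac, hy, ha, hc, h⟩ := star v hv
      have h' : ∀ w, G.Adj v w ↔ w = y ∨ w = a ∨ w = c := fun w => (adj₃ v h1 w).trans (h w)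
      refine ⟨y, (h' y).2 (Or.inl rfl), fun h => absurd h hv, fun _ => ⟨d_center y hy, ?_,
        a, d_one a ha, c, d_one c hc, hac, h'⟩⟩
      intro w hw hvw
      rcases (h' w).1 hvw with rfl | rfl | rfl
      exacts [rfl, absurd (d_one _ ha) hw, absurd (d_one _ hc) hw]
  choose p hp hpW hpZ using exists_p
  have p_center : ∀ v ∉ W, p (p v) = v := fun v hv =>
    ((hpZ (p v) (hpZ v hv).1).2.1 v hv (hp v).symm).symm
  have p_p : ∀ v ∈ W, p v ∈ W → p (p v) = v := by
    intro v hv hpv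
    rcases ((hpW (p v) hpv).2.2 v).1 (hp v).symm with h | h | h
    · refine absurd ?_ (hpW v hv).1
      rw [h, b_inv, ← h]
    · refine absurd ?_ (hpW v hv).2.1
      rw [h, g_inv, ← h]
    · exact h.symm
  have leaf_p : ∀ z ∉ W, ∀ a ∈ W, G.Adj z a → p a = z := by
    intro z hz a ha h
    rcases ((hpW a ha).2.2 z).1 h.symm with h1 | h1 | h1
    · exact absurd (h1 ▸ b_mem a ha) hz
    · exact absurd (h1 ▸ g_mem a ha) hz
    · exact h1.symm
  have exists_t : ∀ v, ∃ q, v ∈ W → p v ∉ W →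
      q ∈ W ∧ q ≠ v ∧ p q = p v ∧ ∀ w ∈ W, p w = p v → w = v ∨ w = q := by
    intro v
    by_cases hpv : p v ∈ W
    · exact ⟨v, fun _ h => absurd hpv h⟩
    by_cases hv : v ∉ W
    · exact ⟨v, fun h => absurd h hv⟩
    rw [not_not] at hv
    obtain ⟨hq, -, a, ha, c, hc, hac, hN⟩ := hpZ (p v) hpv
    have hpa := leaf_p _ hpv a ha ((hN a).2 (by simp))
    have hpc := leaf_p _ hpv c hc ((hN c).2 (by simp))
    have key : ∀ w ∈ W, p w = p v → w = a ∨ w = c := by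
      intro w hw hwv
      rcases (hN w).1 (hwv ▸ (hp w).symm) with h | h
      · exact absurd (h ▸ hw) hq
      · exact h
    rcases key v hv rfl with rfl | rfl
    · exact ⟨c, fun _ _ => ⟨hc, hac.symm, hpc, key⟩⟩
    · exact ⟨a, fun _ _ => ⟨ha, hac, hpa, fun w hw h => (key w hw h).symm⟩⟩
  choose q hq using exists_t
  let t : V → V := fun v => if v ∈ W then if p v ∈ W then p v else q v else v
  have t_off : ∀ v ∉ W, t v = v := fun v hv => by simp only [t, if_neg hv]
  have t_eq_p : ∀ v ∈ W, p v ∈ W → t v = p v := fun v hv h => by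
    simp only [t, if_pos hv, if_pos h]
  have t_eq_q : ∀ v ∈ W, p v ∉ W → t v = q v := fun v hv h => by
    simp only [t, if_pos hv, if_neg h]
  have mem_leaves : ∀ v ∈ W, p v ∉ W → v ∈ leaves G₃ := by
    intro v hv hpv
    have h1 : G₃.Adj (p v) v := (adj₃ _ (star _ hpv).1 v).1 (hp v).symm
    have h2 := G₃.edge_vert h1.symm
    rcases doubleStars_structure hM.doubleStars.1 h2 with h3 | h3
    · exact ⟨h2, h3⟩
    · exact absurd hv (d_center v h3.1)
  -- An edge between two vertices of `W` whose third neighbors are both centers would join two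
  -- leaves.
  have indep : ∀ v ∈ W, p v ∉ W → ∀ w ∈ W, G.Adj v w → p w ∈ W := by
    intro v hv hpv w hw h
    by_contra hpw
    exact hM.doubleStars.2 (mem_leaves v hv hpv) (mem_leaves w hw hpw) h.ne h
  refine ⟨W, b, g, p, t, b_inv, g_inv, fun v => ?_, b_mem, g_mem, b_off, g_off, t_off,
    fun v hv => (hpW v hv).2.2, b_ne_g, fun v hv => (hpW v hv).1, fun v hv => (hpW v hv).2.1,
    p_p, t_eq_p, fun v hv hpv => ?_, fun v hv => ⟨(hpZ v hv).1, p_center v hv, hp v⟩,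
    fun v hv => (hpZ v hv).2.1, fun v hv => ?_, fun v hv hpv => ⟨?_, ?_⟩⟩
  · by_cases hv : v ∈ W
    · by_cases hpv : p v ∈ W
      · rw [t_eq_p v hv hpv, t_eq_p _ hpv (by rwa [p_p v hv hpv]), p_p v hv hpv]
      · obtain ⟨h1, h2, h3, -⟩ := hq v hv hpv
        rw [t_eq_q v hv hpv, t_eq_q _ h1 (by rwa [h3])]
        have h4 := (hq (q v) h1 (by rwa [h3])).2.2.2 v hv h3.symm
        exact (h4.resolve_left h2.symm).symm
    · rw [t_off v hv, t_off v hv]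
  · rw [t_eq_q v hv hpv]
    exact hq v hv hpv
  · obtain ⟨-, -, a, ha, c, -, -, hN⟩ := hpZ v hv
    exact ⟨a, ha, leaf_p v hv a ha ((hN a).2 (by simp))⟩
  · exact indep v hv hpv _ (b_mem v hv) (G₂.adj_sub (adj₂b v hv))
  · exact indep v hv hpv _ (g_mem v hv) (G₂.adj_sub (adj₂g v hv))

end MED

theorem theorem3 {V : Type u} [Fintype V] (G : SimpleGraph V) [DecidableRel G.Adj]
    (hreg : G.IsRegularOfDegree 3) (hMED : MED.HasMEDDecomposition G) :
    MED.IsEdgeChoosable.{u, w} G 7 2 := by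
  obtain ⟨G₁, G₂, G₃, hM⟩ := hMED
  obtain ⟨W, b, g, p, t, F⟩ := hM.exists_frame hreg
  exact F.isEdgeChoosable
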